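/- Let $\lambda/\mu$ be a nonempty edgewise connected skew shape; the content of the box $(a,b)$ (row $a$, column $b$) is $b-a$. A (border) strip is a nonempty edgewise connected skew diagram without a $2\times2$ block; it starts at its lower left box and each box but the last goes right or up to the next one. An outside decomposition $\Pi$ of $\lambda/\mu$ is a partition of its boxes into strips, each of which starts on the left or bottom perimeter and ends on the right or top perimeter of $\lambda/\mu$. A box goes up (right) in $\Pi$ if it does so in its strip; an ending box of a strip goes up if it lies on the top perimeter of $\lambda/\mu$, and right if it lies only on the right perimeter. All boxes of a diagonal then have the same direction. The cutting strip $\phi$ of $\Pi$ is the border strip with one box for each content of $\lambda/\mu$, whose box of content $c$ (for every $c$ but the largest) goes up or right according to the direction of the boxes of content $c$. For $p\le q$ let $s_{[p,q]}$ be the Schur function, in the variables $x_1,x_2,\dots$ and over a commutative ring $K$, of the segment of $\phi$ from content $p$ to content $q$; put $s_{[q+1,q]}=1$, and $s_{[p,q]}=0$ for $p>q+1$. If $\theta_1,\dots,\theta_m$ are the strips of $\Pi$, in any order, and $p(\theta)$, $q(\theta)$ denote the contents of the starting and the ending box of $\theta$, the Hamel–Goulden determinant is $$D(\Pi)=\det\bigl[s_{\theta_k\#\theta_l}\bigr]_{k,l=1}^m,\qquad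 s_{\theta_k\#\theta_l}=s_{[p(\theta_l),\,q(\theta_k)]}.$$ **Theorem.** Let $\Pi$ be an outside decomposition of $\lambda/\mu$ and let $i$ be the content of a diagonal of $\lambda/\mu$. Then there is exactly one outside decomposition $\omega_i(\Pi)$ of $\lambda/\mu$ in which, on every diagonal other than the one of largest content, the boxes of content $i$ have the direction opposite to their direction in $\Pi$ and all other boxes have the same direction as in $\Pi$ (so $\omega_i(\Pi)=\Pi$ if $i$ is the largest content). For all orders of the strips of $\Pi$ and of $\omega_i(\Pi)$, the determinant $D(\omega_i(\Pi))$ can be obtained from $D(\Pi)$ by finitely many elementary determinantal operations, each of which leaves the value unchanged when one keeps track of an invertible scalar of $K$ in front of the determinant: interchanging two rows or two columns; multiplying a row or a column by an invertible scalar of $K$; adding to a row (column) another row (column) multiplied by a symmetric function over $K$; bordering the matrix with, or deleting, a unit diagonal block. The scalar in front is $1$ at the beginning and at the end. In particular $D(\omega_i(\Pi))=D(\Pi)$. -/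

import Mathlib

open scoped Classical

noncomputable section

/-! ### Boxes, skew diagrams, strips -/

/-- A box of the plane: `(i, j)` is the box in row `i` (counted from the top) and column `j`. -/
abbrev Cell : Type := ℤ × ℤ

/-- The content `j - i` of the box `(i, j)`. -/
def content (b : Cell) : ℤ := b.2 - b.1

/-- `c` is the box immediately to the right of `b`. -/
def IsRightOf (b c : Cell) : Prop := c = (b.1, b.2 + 1)

/-- `c` is the box immediately on top of `b`. -/
def IsAbove (b c : Cell) : Prop := c = (b.1 - 1, b.2)

/-- The diagram of the skew shape `lam / mu`. Rows and columns are numbered from `0`, as in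
`YoungDiagram`; this does not affect contents. -/
def skewDiagram (lam mu : YoungDiagram) : Finset Cell :=
  (lam.cells \ mu.cells).image fun b => ((b.1 : ℤ), (b.2 : ℤ))

/-- `T` is a skew diagram, up to its position in the plane. -/
def IsSkewDiagram (T : Finset Cell) : Prop :=
  ∃ (lam mu : YoungDiagram) (v : Cell), mu ≤ lam ∧ T = (skewDiagram lam mu).image fun b => b + v

/-- Two boxes are adjacent if they share a common edge. -/
def cellGraph : SimpleGraph Cell :=
  SimpleGraph.fromRel fun b c => IsRightOf b c ∨ IsAbove b c

/-- `T` is nonempty and edgewise connected. -/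
def IsEdgeConnected (T : Finset Cell) : Prop :=
  (cellGraph.induce (T : Set Cell)).Connected

/-- A border strip: an edgewise connected skew diagram without a `2 × 2` block of boxes. -/
def IsStrip (T : Finset Cell) : Prop :=
  IsSkewDiagram T ∧ IsEdgeConnected T ∧
    ∀ i j : ℤ, ¬ ((i, j) ∈ T ∧ (i, j + 1) ∈ T ∧ (i + 1, j) ∈ T ∧ (i + 1, j + 1) ∈ T)

/-- The starting box of a strip is its lower left box, i.e. the one of smallest content. -/
def IsStartBox (T : Finset Cell) (b : Cell) : Prop :=
  b ∈ T ∧ ∀ c ∈ T, content b ≤ content c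

/-- The ending box of a strip is its upper right box, i.e. the one of largest content. -/
def IsEndBox (T : Finset Cell) (b : Cell) : Prop :=
  b ∈ T ∧ ∀ c ∈ T, content c ≤ content b

/-- The content `p(θ)` of the starting box. -/
def startContent (T : Finset Cell) : ℤ := sInf (content '' (T : Set Cell))

/-- The content `q(θ)` of the ending box. -/
def endContent (T : Finset Cell) : ℤ := sSup (content '' (T : Set Cell))

/-- The box `b` of the diagram `S` lies on the left perimeter of `S`. -/
def OnLeft (S : Finset Cell) (b : Cell) : Prop := ∀ c ∈ S, ¬ IsRightOf c b

/-- The box `b` of the diagram `S` lies on the bottom perimeter of `S`. -/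
def OnBottom (S : Finset Cell) (b : Cell) : Prop := ∀ c ∈ S, ¬ IsAbove c b

/-- The box `b` of the diagram `S` lies on the right perimeter of `S`. -/
def OnRight (S : Finset Cell) (b : Cell) : Prop := ∀ c ∈ S, ¬ IsRightOf b c

/-- The box `b` of the diagram `S` lies on the top perimeter of `S`. -/
def OnTop (S : Finset Cell) (b : Cell) : Prop := ∀ c ∈ S, ¬ IsAbove b c

/-- The set of contents of the boxes of `S`; it indexes the diagonals of `S`. -/
def diagonals (S : Finset Cell) : Finset ℤ := S.image content

/-! ### Outside decompositions, directions, twists -/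

/-- An outside decomposition of `S`: a partition of the boxes of `S` into border strips, each of
which starts on the left or bottom perimeter and ends on the right or top perimeter of `S`. -/
structure OutsideDecomposition (S : Finset Cell) extends Finpartition S where
  isStrip : ∀ T ∈ parts, IsStrip T
  start_mem : ∀ T ∈ parts, ∀ b, IsStartBox T b → OnLeft S b ∨ OnBottom S b
  end_mem : ∀ T ∈ parts, ∀ b, IsEndBox T b → OnRight S b ∨ OnTop S b

/-- The box `b` goes up: the next box of its strip is on top of it, or it is the ending box of its
strip and lies on the top perimeter of `S`. -/
def GoesUp {S : Finset Cell} (P : OutsideDecomposition S) (b : Cell) : Prop :=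
  ∃ T ∈ P.parts, b ∈ T ∧ ((∃ c ∈ T, IsAbove b c) ∨ (IsEndBox T b ∧ OnTop S b))

/-- The box `b` goes right: the next box of its strip is to its right, or it is the ending box of
its strip and lies on the right perimeter of `S` (a corner, on both perimeters, goes up). -/
def GoesRight {S : Finset Cell} (P : OutsideDecomposition S) (b : Cell) : Prop :=
  ∃ T ∈ P.parts, b ∈ T ∧
    ((∃ c ∈ T, IsRightOf b c) ∨ (IsEndBox T b ∧ OnRight S b ∧ ¬ OnTop S b))

/-- `P'` is the twist `ω_i(P)`: the boxes of content `i` change their direction, all the others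
keep it. The direction of the last diagonal (no box of `S` has the next content) is a pure
convention, carries no information and is not compared; for it `ω_i` is the identity. -/
def IsTwist {S : Finset Cell} (i : ℤ) (P P' : OutsideDecomposition S) : Prop :=
  ∀ b ∈ S, content b + 1 ∈ diagonals S →
    (content b ≠ i → ((GoesUp P' b ↔ GoesUp P b) ∧ (GoesRight P' b ↔ GoesRight P b))) ∧
    (content b = i → ((GoesUp P' b ↔ GoesRight P b) ∧ (GoesRight P' b ↔ GoesUp P b)))

/-! ### The cutting strip -/

/-- The diagonal of content `c` goes up with respect to `P`; all boxes of a diagonal of an outside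
decomposition have the same direction. -/
def DiagonalGoesUp {S : Finset Cell} (P : OutsideDecomposition S) (c : ℤ) : Prop :=
  ∃ b ∈ S, content b = c ∧ GoesUp P b

/-- The box of content `c` of the cutting strip of `P`: the strip moves one row up after each
diagonal that goes up, and one column to the right after each diagonal that goes right. -/
def cuttingBox {S : Finset Cell} (P : OutsideDecomposition S) (c : ℤ) : Cell :=
  let r : ℤ := -(((diagonals S).filter fun e => e < c ∧ DiagonalGoesUp P e).card : ℤ)
  (r, c + r)

/-- The segment `φ[p, q]` of the cutting strip `φ` of `P`, for contents `p, q` of `S`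
(empty for `q < p`). -/
def cuttingSegment {S : Finset Cell} (P : OutsideDecomposition S) (p q : ℤ) : Finset Cell :=
  (Finset.Icc p q).image (cuttingBox P)

/-! ### Skew Schur functions -/

/-- Semistandard fillings: rows weakly increase from left to right and columns strictly increase
from top to bottom. -/
def IsSemistandard {T : Finset Cell} (f : T → ℕ) : Prop :=
  (∀ b c : T, b.1.1 = c.1.1 → b.1.2 < c.1.2 → f b ≤ f c) ∧
  (∀ b c : T, b.1.2 = c.1.2 → b.1.1 < c.1.1 → f b < f c)

/-- The Schur function of a skew diagram `T` in the variables `x_0, x_1, x_2, …`: the coefficient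
of a monomial is the number of semistandard fillings of `T` of that weight. -/
def skewSchur (K : Type*) [CommRing K] (T : Finset Cell) : MvPowerSeries ℕ K :=
  fun w => (Nat.card {f : T → ℕ // IsSemistandard f ∧ ∑ b, Finsupp.single (f b) 1 = w} : K)

/-- The algebra of symmetric functions over `K`, as the subalgebra of the power series in
`x_0, x_1, x_2, …` generated by the skew Schur functions. -/
def symmetricFunctions (K : Type*) [CommRing K] : Subalgebra K (MvPowerSeries ℕ K) :=
  Algebra.adjoin K {f | ∃ T : Finset Cell, IsSkewDiagram T ∧ f = skewSchur K T}

/-- The Schur function of `φ[p, q]`: it is `1` for the empty segment `φ[q + 1, q]`, and `0` if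
`φ[p, q]` is undefined, i.e. `p > q + 1`. -/
def segmentSchur (K : Type*) [CommRing K] {S : Finset Cell} (P : OutsideDecomposition S)
    (p q : ℤ) : MvPowerSeries ℕ K :=
  if p ≤ q then skewSchur K (cuttingSegment P p q) else if p = q + 1 then 1 else 0

/-- The Hamel–Goulden matrix of `P`, indexed by the strips of `P`. Its `(θ, η)` entry is the Schur
function of `θ # η = φ[p(η), q(θ)]`. -/
def hgMatrix (K : Type*) [CommRing K] {S : Finset Cell} (P : OutsideDecomposition S) :
    Matrix {T // T ∈ P.parts} {T // T ∈ P.parts} (MvPowerSeries ℕ K) :=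
  Matrix.of fun θ η => segmentSchur K P (startContent η.1) (endContent θ.1)

/-- The value of the Hamel–Goulden determinant `D(P)`; it does not depend on an order of the
strips. -/
def hgDet (K : Type*) [CommRing K] {S : Finset Cell} (P : OutsideDecomposition S) :
    MvPowerSeries ℕ K :=
  (hgMatrix K P).det

/-! ### Elementary determinantal operations -/

/-- A formal expression `scalar · det mat`, with an invertible scalar in front of the determinant
of a matrix of any size. -/
structure DetExpr (K R : Type*) [CommRing K] where
  scalar : Kˣ
  size : ℕ
  mat : Matrix (Fin size) (Fin size) R

/-- One elementary determinantal operation, with the scalar factor in front of the determinant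
adjusted so that the value of the expression does not change: interchanging two rows or columns,
multiplying a row or column by an invertible scalar of `K`, adding to a row or column a multiple
(with a factor from the subalgebra `A`) of another one, and bordering with, or deleting, a unit
diagonal block. -/
inductive DetStep {K R : Type*} [CommRing K] [CommRing R] [Algebra K R] (A : Subalgebra K R) :
    DetExpr K R → DetExpr K R → Prop
  | swapRows {n : ℕ} (a : Kˣ) (M : Matrix (Fin n) (Fin n) R) (i j : Fin n) (hij : i ≠ j) :
      DetStep A ⟨a, n, M⟩ ⟨-a, n, M.submatrix (Equiv.swap i j) id⟩
  | swapCols {n : ℕ} (a : Kˣ) (M : Matrix (Fin n) (Fin n) R) (i j : Fin n) (hij : i ≠ j) :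
      DetStep A ⟨a, n, M⟩ ⟨-a, n, M.submatrix id (Equiv.swap i j)⟩
  | mulRow {n : ℕ} (a : Kˣ) (M : Matrix (Fin n) (Fin n) R) (i : Fin n) (u : Kˣ) :
      DetStep A ⟨a, n, M⟩ ⟨a * u⁻¹, n, M.updateRow i fun k => (u : K) • M i k⟩
  | mulCol {n : ℕ} (a : Kˣ) (M : Matrix (Fin n) (Fin n) R) (j : Fin n) (u : Kˣ) :
      DetStep A ⟨a, n, M⟩ ⟨a * u⁻¹, n, M.updateCol j fun k => (u : K) • M k j⟩
  | addRow {n : ℕ} (a : Kˣ) (M : Matrix (Fin n) (Fin n) R) (i j : Fin n) (hij : i ≠ j)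
      (r : R) (hr : r ∈ A) :
      DetStep A ⟨a, n, M⟩ ⟨a, n, M.updateRow i fun k => M i k + r * M j k⟩
  | addCol {n : ℕ} (a : Kˣ) (M : Matrix (Fin n) (Fin n) R) (i j : Fin n) (hij : i ≠ j)
      (r : R) (hr : r ∈ A) :
      DetStep A ⟨a, n, M⟩ ⟨a, n, M.updateCol i fun k => M k i + r * M k j⟩
  | border {n : ℕ} (a : Kˣ) (M : Matrix (Fin n) (Fin n) R) (k : ℕ) :
      DetStep A ⟨a, n, M⟩ ⟨a, n + k,
        (Matrix.fromBlocks M 0 0 (1 : Matrix (Fin k) (Fin k) R)).submatrix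
          finSumFinEquiv.symm finSumFinEquiv.symm⟩
  | unborder {n : ℕ} (a : Kˣ) (M : Matrix (Fin n) (Fin n) R) (k : ℕ) :
      DetStep A ⟨a, n + k,
        (Matrix.fromBlocks M 0 0 (1 : Matrix (Fin k) (Fin k) R)).submatrix
          finSumFinEquiv.symm finSumFinEquiv.symm⟩ ⟨a, n, M⟩

/-- `E'` can be obtained from `E` by elementary determinantal operations. -/
def ObtainableFrom {K R : Type*} [CommRing K] [CommRing R] [Algebra K R] (A : Subalgebra K R)
    (E E' : DetExpr K R) : Prop :=
  Relation.ReflTransGen (DetStep A) E E'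

/-- The determinant `D(P)` as an expression, for the order `θ_1, …, θ_m` of the strips of `P` given
by `e`. -/
def hgExpr (K : Type*) [CommRing K] {S : Finset Cell} (P : OutsideDecomposition S) {m : ℕ}
    (e : Fin m ≃ {T // T ∈ P.parts}) : DetExpr K (MvPowerSeries ℕ K) :=
  ⟨1, m, (hgMatrix K P).submatrix e e⟩

end

/-! An outside decomposition is encoded by the set `D` of contents whose diagonals go up. The
infinite strips with directions `D` are parallel and cover the plane, and the strips of the
decomposition are the connected pieces in which they meet the shape. Every `D` therefore comes from
exactly one decomposition (`lineDecomposition_isDirectionSet`, `IsDirectionSet.unique`), the largest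
content being irrelevant, and the twist replaces `D` by `symmDiff D {i}`.

A twist can change the number of strips, so the Hamel–Goulden determinants before and after it are
compared through matrices of one common size. `boxMatrix` is indexed by all boxes: the row of a box
that is not an ending box has the single entry `-1` at its next box, and the row of an ending box
carries the Schur functions, in the columns of the starting boxes. Bordering with a unit block and
unitriangular row operations lead from one matrix to the other (`IsDirectionSet.hgMatrix_detEquiv`).

Let `W` and `W'` be the box matrices before and after the twist, cut into four blocks by whether the
content is at most `i`. For rows of content greater than `i` and columns of content at most `i`, the
identity `s[p,i] * s[i+1,q] = s[p,q] + s'[p,q]` (`segmentSeries_mul`) makes `W + W'` a matrix of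
rank one. In the opposite block only entries between the diagonals `i` and `i + 1` can be nonzero.
In the two remaining blocks the matrices differ only in rows of content `i` or columns of content `i
+ 1`.

By connectedness and convexity these two diagonals differ in length by at most one, and the twist
shifts the matching between them by one box. A cyclic rotation of the columns of diagonal `i + 1`,
column and row operations that subtract the rank-one part, and a change of sign of all rows and
columns of content greater than `i` turn `W` into `W'` (`DetEquiv.of_shift`). If diagonal `i + 1` is
the shorter one, the same is done with the transposes. -/

noncomputable section

/-! ### Calculus of elementary determinantal operations -/

section DetOperations

variable {K R : Type*} [CommRing K] [CommRing R] [Algebra K R] {A : Subalgebra K R}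

theorem DetStep.symm {E E' : DetExpr K R} (h : DetStep A E E') : DetStep A E' E := by
  cases h with
  | swapRows a M i j hij =>
    have := DetStep.swapRows (A := A) (-a) (M.submatrix (Equiv.swap i j) id) i j hij
    have h : ⇑(Equiv.swap i j) ∘ ⇑(Equiv.swap i j) = id := by ext; simp
    simpa [Matrix.submatrix_submatrix, h] using this
  | swapCols a M i j hij =>
    have := DetStep.swapCols (A := A) (-a) (M.submatrix id (Equiv.swap i j)) i j hij
    have h : ⇑(Equiv.swap i j) ∘ ⇑(Equiv.swap i j) = id := by ext; simp
    simpa [Matrix.submatrix_submatrix, h] using this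
  | mulRow a M i u =>
    have := DetStep.mulRow (A := A) (a * u⁻¹) (M.updateRow i fun k => (u : K) • M i k) i u⁻¹
    simpa [smul_smul] using this
  | mulCol a M i u =>
    have := DetStep.mulCol (A := A) (a * u⁻¹) (M.updateCol i fun k => (u : K) • M k i) i u⁻¹
    simpa [smul_smul] using this
  | addRow a M i j hij r hr =>
    have := DetStep.addRow (A := A) a (M.updateRow i fun k => M i k + r * M j k) i j hij (-r)
      (neg_mem hr)
    simpa [Matrix.updateRow_ne hij.symm] using this
  | addCol a M i j hij r hr =>
    have := DetStep.addCol (A := A) a (M.updateCol i fun k => M k i + r * M k j) i j hij (-r)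
      (neg_mem hr)
    simpa [Matrix.updateCol_ne hij.symm] using this
  | border a M k => exact .unborder a M k
  | unborder a M k => exact .border a M k

theorem ObtainableFrom.symm {E E' : DetExpr K R} (h : ObtainableFrom A E E') :
    ObtainableFrom A E' E := by
  induction h with
  | refl => exact .refl
  | tail _ h ih => exact .head h.symm ih

/-- The value of a formal expression `scalar · det mat`. -/
def DetExpr.value (E : DetExpr K R) : R := algebraMap K R E.scalar * E.mat.det

theorem DetStep.value_eq {E E' : DetExpr K R} (h : DetStep A E E') : E'.value = E.value := by
  cases h with
  | swapRows a M i j hij =>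
    simp [DetExpr.value, Matrix.det_permute, Equiv.Perm.sign_swap hij]
  | swapCols a M i j hij =>
    simp [DetExpr.value, Matrix.det_permute', Equiv.Perm.sign_swap hij]
  | mulRow a M i u =>
    have := Matrix.det_updateRow_smul M i (algebraMap K R u) (M i)
    simp only [DetExpr.value, Algebra.smul_def]
    rw [show (fun k => algebraMap K R u * M i k) = algebraMap K R u • M i from rfl, this,
      Matrix.updateRow_eq_self, ← mul_assoc, ← map_mul]
    simp
  | mulCol a M i u =>
    have := Matrix.det_updateCol_smul M i (algebraMap K R u) (M.col i)
    simp only [DetExpr.value, Algebra.smul_def]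
    rw [show (fun k => algebraMap K R u * M k i) = algebraMap K R u • M.col i from rfl, this,
      show M.updateCol i (M.col i) = M from Matrix.updateCol_eq_self M i, ← mul_assoc, ← map_mul]
    simp
  | addRow a M i j hij r hr =>
    have := Matrix.det_updateRow_add_smul_self M hij r
    simp only [DetExpr.value]
    rw [← this]; rfl
  | addCol a M i j hij r hr =>
    have := Matrix.det_updateCol_add_smul_self M hij r
    simp only [DetExpr.value]
    rw [← this]; rfl
  | border a M k => simp [DetExpr.value, Matrix.det_submatrix_equiv_self]
  | unborder a M k => simp [DetExpr.value, Matrix.det_submatrix_equiv_self]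

theorem ObtainableFrom.value_eq {E E' : DetExpr K R} (h : ObtainableFrom A E E') :
    E'.value = E.value := by
  induction h with
  | refl => rfl
  | tail _ h ih => exact h.value_eq.trans ih

theorem DetStep.transpose {E E' : DetExpr K R} (h : DetStep A E E') :
    DetStep A ⟨E.scalar, E.size, E.mat.transpose⟩ ⟨E'.scalar, E'.size, E'.mat.transpose⟩ := by
  cases h with
  | swapRows a M i j hij => exact .swapCols a M.transpose i j hij
  | swapCols a M i j hij => exact .swapRows a M.transpose i j hij
  | mulRow a M i u =>
    have := DetStep.mulCol (A := A) a M.transpose i u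
    simpa [Matrix.updateCol_transpose] using this
  | mulCol a M i u =>
    have := DetStep.mulRow (A := A) a M.transpose i u
    simpa [Matrix.updateRow_transpose] using this
  | addRow a M i j hij r hr =>
    have := DetStep.addCol (A := A) a M.transpose i j hij r hr
    simpa [Matrix.updateCol_transpose] using this
  | addCol a M i j hij r hr =>
    have := DetStep.addRow (A := A) a M.transpose i j hij r hr
    simpa [Matrix.updateRow_transpose] using this
  | border a M k =>
    have := DetStep.border (A := A) a M.transpose k
    simpa [Matrix.fromBlocks_transpose] using this
  | unborder a M k =>
    have := DetStep.unborder (A := A) a M.transpose k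
    simpa [Matrix.fromBlocks_transpose] using this

theorem ObtainableFrom.transpose {E E' : DetExpr K R} (h : ObtainableFrom A E E') :
    ObtainableFrom A ⟨E.scalar, E.size, E.mat.transpose⟩
      ⟨E'.scalar, E'.size, E'.mat.transpose⟩ := by
  induction h with
  | refl => exact .refl
  | tail _ h ih => exact .tail ih h.transpose

/-- Each transposition is applied to the rows and to the columns, so the two signs in the scalar
cancel. This is why the order of the strips does not matter. -/
theorem obtainableFrom_submatrix_perm {n : ℕ} (a : Kˣ) (M : Matrix (Fin n) (Fin n) R)
    (σ : Equiv.Perm (Fin n)) : ObtainableFrom A ⟨a, n, M⟩ ⟨a, n, M.submatrix σ σ⟩ := by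
  induction σ using Equiv.Perm.swap_induction_on' with
  | one => exact .refl
  | mul_swap f x y hxy ih =>
    refine (ih.tail (.swapRows a _ x y hxy)).tail ?_
    have := DetStep.swapCols (A := A) (-a)
      ((M.submatrix f f).submatrix (Equiv.swap x y) id) x y hxy
    simpa [Matrix.submatrix_submatrix, Function.comp_def] using this

/-- Two square matrices, over any index types, whose determinants can be obtained from each other
by elementary operations, with the same scalar factor at the beginning and at the end. -/
def DetEquiv (A : Subalgebra K R) {ι κ : Type*} (M : Matrix ι ι R) (N : Matrix κ κ R) : Prop :=
  ∀ (a : Kˣ) (m n : ℕ) (e : Fin m ≃ ι) (f : Fin n ≃ κ),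
    ObtainableFrom A ⟨a, m, M.submatrix e e⟩ ⟨a, n, N.submatrix f f⟩

variable {ι κ μ : Type*}

theorem DetEquiv.symm {M : Matrix ι ι R} {N : Matrix κ κ R} (h : DetEquiv A M N) :
    DetEquiv A N M :=
  fun a m n e f => (h a n m f e).symm

/-- An ordering of the middle index type is needed to pass through `N`; for an infinite index type
`DetEquiv` holds vacuously. -/
theorem DetEquiv.trans [Finite κ] {M : Matrix ι ι R} {N : Matrix κ κ R} {L : Matrix μ μ R}
    (h : DetEquiv A M N) (h' : DetEquiv A N L) : DetEquiv A M L := by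
  intro a m n e f
  obtain ⟨k, ⟨g⟩⟩ := Finite.exists_equiv_fin κ
  exact (h a m k e g.symm).trans (h' a k n g.symm f)

theorem DetEquiv.transpose {M : Matrix ι ι R} {N : Matrix κ κ R} (h : DetEquiv A M N) :
    DetEquiv A M.transpose N.transpose :=
  fun a m n e f => (h a m n e f).transpose

theorem DetEquiv.reindex (M : Matrix ι ι R) (e : κ ≃ ι) :
    DetEquiv A M (M.submatrix e e) := by
  intro a m n f g
  obtain rfl : m = n := by simpa using Fintype.card_congr ((f.trans e.symm).trans g.symm)
  have := obtainableFrom_submatrix_perm (A := A) a (M.submatrix f f) ((g.trans e).trans f.symm)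
  simpa [Matrix.submatrix_submatrix, Function.comp_def] using this

theorem DetEquiv.refl (M : Matrix ι ι R) : DetEquiv A M M :=
  DetEquiv.reindex M (Equiv.refl ι)

theorem DetEquiv.of_eq {M N : Matrix ι ι R} (h : M = N) : DetEquiv A M N := h ▸ .refl M

theorem DetEquiv.of_exists {M : Matrix ι ι R} {N : Matrix κ κ R} {m n : ℕ} (e : Fin m ≃ ι)
    (f : Fin n ≃ κ)
    (h : ∀ a : Kˣ, ObtainableFrom A ⟨a, m, M.submatrix e e⟩ ⟨a, n, N.submatrix f f⟩) :
    DetEquiv A M N := fun a m' n' e' f' =>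
  ((DetEquiv.refl M a m' m e' e).trans (h a)).trans (DetEquiv.refl N a n n' f f')

theorem DetEquiv.border [Finite ι] [Finite κ] [DecidableEq κ] (M : Matrix ι ι R) :
    DetEquiv A M (Matrix.fromBlocks M 0 0 (1 : Matrix κ κ R)) := by
  obtain ⟨m, ⟨e⟩⟩ := Finite.exists_equiv_fin ι
  obtain ⟨k, ⟨f⟩⟩ := Finite.exists_equiv_fin κ
  refine .of_exists e.symm (finSumFinEquiv.symm.trans (Equiv.sumCongr e.symm f.symm)) fun a => ?_
  refine .single ?_
  have := DetStep.border (A := A) a (M.submatrix e.symm e.symm) k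
  convert this using 2
  ext i j
  simp only [Matrix.submatrix_apply, Equiv.trans_apply]
  generalize finSumFinEquiv.symm i = i'
  generalize finSumFinEquiv.symm j = j'
  rcases i' with i' | i' <;> rcases j' with j' | j' <;> simp [Matrix.one_apply]

variable [Finite ι] [DecidableEq ι]

theorem DetEquiv.addRow (M : Matrix ι ι R) {i j : ι} (hij : i ≠ j) {r : R} (hr : r ∈ A) :
    DetEquiv A M (M.updateRow i fun k => M i k + r * M j k) := by
  obtain ⟨m, ⟨e⟩⟩ := Finite.exists_equiv_fin ι
  refine .of_exists e.symm e.symm fun a => .single ?_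
  have := DetStep.addRow (A := A) a (M.submatrix e.symm e.symm) (e i) (e j) (by simpa) r hr
  convert this using 2
  rw [Matrix.submatrix_updateRow_equiv]
  simp

/-- Interchanging two columns and changing the sign of one of them. -/
theorem DetEquiv.signedSwap (M : Matrix ι ι R) {i j : ι} (hij : i ≠ j) :
    DetEquiv A M (Matrix.of fun r c =>
      if c = i then M r j else if c = j then -M r i else M r c) := by
  obtain ⟨m, ⟨e⟩⟩ := Finite.exists_equiv_fin ι
  refine .of_exists e.symm e.symm fun a => ?_
  refine .tail (.single (.swapCols a _ (e i) (e j) (by simpa))) ?_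
  have := DetStep.mulCol (A := A) (-a)
    ((M.submatrix e.symm e.symm).submatrix id (Equiv.swap (e i) (e j))) (e j) (-1)
  convert this using 2
  · simp
  · ext r c
    obtain ⟨c, rfl⟩ := e.surjective c
    by_cases h1 : c = i
    · subst h1; simp [hij]
    · by_cases h2 : c = j
      · subst h2; simp [h1]
      · simp [h1, h2, Equiv.swap_apply_of_ne_of_ne]

/-- Changing the sign of a row and of the column with the same index. -/
theorem DetEquiv.negRowCol (M : Matrix ι ι R) (i : ι) :
    DetEquiv A M (Matrix.of fun r c =>
      (if r = i then -1 else 1) * (if c = i then -1 else 1) * M r c) := by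
  obtain ⟨m, ⟨e⟩⟩ := Finite.exists_equiv_fin ι
  refine .of_exists e.symm e.symm fun a => ?_
  refine .tail (.single (.mulRow a _ (e i) (-1))) ?_
  have := DetStep.mulCol (A := A) (a * (-1)⁻¹)
    ((M.submatrix e.symm e.symm).updateRow (e i) fun k =>
      ((-1 : Kˣ) : K) • M.submatrix e.symm e.symm (e i) k) (e i) (-1)
  convert this using 2
  · simp
  · ext r c
    obtain ⟨c, rfl⟩ := e.surjective c
    obtain ⟨r, rfl⟩ := e.surjective r
    by_cases h1 : c = i <;> by_cases h2 : r = i <;>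
      simp [Matrix.updateRow_apply, h1, h2]

theorem DetEquiv.negRowsCols (M : Matrix ι ι R) (s : Finset ι) :
    DetEquiv A M (Matrix.of fun r c =>
      (if r ∈ s then -1 else 1) * (if c ∈ s then -1 else 1) * M r c) := by
  induction s using Finset.induction_on with
  | empty => exact .of_eq (by ext; simp)
  | insert x s hx ih =>
    refine (ih.trans (.negRowCol _ x)).trans (.of_eq ?_)
    ext r c
    by_cases h1 : r = x <;> by_cases h2 : c = x <;> (simp [h1, h2, hx]; try (split_ifs <;> simp))

theorem DetEquiv.addRows (M : Matrix ι ι R) (i : ι) (T : ι → R) (hT : ∀ j, T j ∈ A)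
    (s : Finset ι) (hi : i ∉ s) :
    DetEquiv A M (M.updateRow i fun k => M i k + ∑ j ∈ s, T j * M j k) := by
  induction s using Finset.induction_on with
  | empty => exact .of_eq (by simp)
  | insert x s hx ih =>
    simp only [Finset.mem_insert, not_or] at hi
    refine ((ih hi.2).trans (.addRow _ (j := x) hi.1 (hT x))).trans (.of_eq ?_)
    ext r c
    by_cases h1 : r = i
    · subst h1
      simp [Matrix.updateRow_apply, Finset.sum_insert hx, Ne.symm hi.1]
      ring
    · simp [Matrix.updateRow_apply, h1]

/-- Row operations with a unitriangular matrix `1 + T`. -/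
theorem DetEquiv.triangular [Fintype ι] (M : Matrix ι ι R) (T : Matrix ι ι R)
    (hT : ∀ i j, T i j ∈ A) (g : ι → ℤ) (hg : ∀ i j, T i j ≠ 0 → g i < g j) :
    DetEquiv A M (Matrix.of fun r c => M r c + ∑ j, T r j * M j c) := by
  suffices H : ∀ s : Finset ι, DetEquiv A M (Matrix.of fun r c =>
      if r ∈ s then M r c + ∑ j, T r j * M j c else M r c) by
    simpa using H Finset.univ
  intro s
  -- Rows are treated in increasing order of `g`. The rows that are added to row `x` have larger
  -- `g`, hence are still rows of the original `M`.
  induction s using Finset.induction_on_max_value g with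
  | empty => exact .of_eq (by ext; simp)
  | insert x s hx hmax ih =>
    refine (ih.trans (.addRows _ x (T x) (hT x) (Finset.univ.filter fun j => g x < g j)
      (by simp))).trans (.of_eq ?_)
    ext r c
    by_cases h1 : r = x
    · subst h1
      simp only [Matrix.updateRow_self, Matrix.of_apply, hx, if_false, Finset.mem_insert, true_or,
        if_true]
      congr 1
      rw [Finset.sum_filter]
      refine Finset.sum_congr rfl fun j _ => ?_
      split_ifs with h2 h3
      · exact absurd (hmax j h3) (not_le.mpr h2)
      · rfl
      · by_contra h4
        exact h2 (hg r j (fun h5 => h4 (by simp [h5])))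
    · simp [Matrix.updateRow_apply, h1]

/-- Column operations with a unitriangular matrix `1 + T`. -/
theorem DetEquiv.triangular_cols [Fintype ι] (M : Matrix ι ι R) (T : Matrix ι ι R)
    (hT : ∀ i j, T i j ∈ A) (g : ι → ℤ) (hg : ∀ i j, T i j ≠ 0 → g i < g j) :
    DetEquiv A M (Matrix.of fun r c => M r c + ∑ j, M r j * T j c) := by
  have := (DetEquiv.triangular M.transpose T.transpose (fun i j => hT j i) (fun i => -g i)
    (fun i j h => by have := hg j i h; lia)).transpose
  refine DetEquiv.trans (by simpa using this) (.of_eq ?_)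
  ext r c
  simp [mul_comm]

/-- Cyclic permutation of columns, with the signs that keep the determinant. -/
theorem DetEquiv.rotateCols (M : Matrix ι ι R) (v : ℕ → ι) (n : ℕ)
    (hv : ∀ j ≤ n, ∀ k ≤ n, v j = v k → j = k) :
    ∃ N : Matrix ι ι R, DetEquiv A M N ∧ (∀ r, N r (v 0) = M r (v n)) ∧
      (∀ r, ∀ k < n, N r (v (k + 1)) = -M r (v k)) ∧
      ∀ r c, (∀ k ≤ n, c ≠ v k) → N r c = M r c := by
  induction n with
  | zero => exact ⟨M, .refl M, fun _ => rfl, fun _ k hk => absurd hk (by lia), fun _ _ _ => rfl⟩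
  | succ n ih =>
    obtain ⟨N, h1, h2, h3, h4⟩ := ih fun j hj k hk => hv j (by lia) k (by lia)
    have hne : ∀ j ≤ n + 1, ∀ k ≤ n + 1, j ≠ k → v j ≠ v k :=
      fun j hj k hk h h' => h (hv j hj k hk h')
    have h0 : v 0 ≠ v (n + 1) := hne _ (by lia) _ le_rfl (by lia)
    -- Column `v 0` of `N` is the old column `v n`; the signed swap moves it, negated, to `v (n +
    -- 1)` and brings the old column `v (n + 1)` to `v 0`.
    refine ⟨_, h1.trans (.signedSwap N h0), fun r => ?_, fun r k hk => ?_, fun r c hc => ?_⟩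
    · simpa using h4 r _ fun k hk => hne _ le_rfl _ (by lia) (by lia)
    · simp only [Matrix.of_apply]
      rw [if_neg (hne _ (by lia) _ (by lia) (by lia))]
      rcases Nat.lt_succ_iff_lt_or_eq.1 hk with hk | rfl
      · rw [if_neg (hne _ (by lia) _ (by lia) (by lia)), h3 r k hk]
      · simp [h2]
    · simp only [Matrix.of_apply]
      rw [if_neg (hc _ (by lia)), if_neg (hc _ le_rfl), h4 r c fun k hk => hc k (by lia)]

end DetOperations

/-! ### Generating functions of fillings -/

section FillingSeries

variable (K : Type*) [CommRing K]

/-- The generating function of the fillings of a finite set that satisfy a given condition. -/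
def fillingSeries {X : Type*} [Fintype X] (Φ : (X → ℕ) → Prop) : MvPowerSeries ℕ K :=
  fun w => (Nat.card {f : X → ℕ // Φ f ∧ ∑ b, Finsupp.single (f b) 1 = w} : K)

theorem skewSchur_eq_fillingSeries (T : Finset Cell) :
    skewSchur K T = fillingSeries K (fun f : T → ℕ => IsSemistandard f) := rfl

theorem coeff_fillingSeries {X : Type*} [Fintype X] (Φ : (X → ℕ) → Prop) (w : ℕ →₀ ℕ) :
    MvPowerSeries.coeff w (fillingSeries K Φ) =
      (Nat.card {f : X → ℕ // Φ f ∧ ∑ b, Finsupp.single (f b) 1 = w} : K) := rfl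

/-- All values of a filling of weight `w` lie in the support of `w`. Finiteness matters because
`Nat.card` is `0` on infinite types, which would break additivity. -/
theorem finite_fillings {X : Type*} [Fintype X] (Φ : (X → ℕ) → Prop) (w : ℕ →₀ ℕ) :
    Finite {f : X → ℕ // Φ f ∧ ∑ b, Finsupp.single (f b) 1 = w} := by
  have : Finite {f : X → ℕ // ∀ x, f x ∈ w.support} := by
    refine Set.finite_coe_iff.mpr ?_
    have := Set.Finite.pi' (ι := X) (t := fun _ => (w.support : Set ℕ))
      fun _ => w.support.finite_toSet
    exact this
  refine Finite.of_injective (β := {f : X → ℕ // ∀ x, f x ∈ w.support})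
    (fun f => ⟨f.1, fun x => ?_⟩) fun f g h => Subtype.ext (by simpa using h)
  rw [Finsupp.mem_support_iff]
  have hw := DFunLike.congr_fun f.2.2 (f.1 x)
  rw [Finsupp.finsetSum_apply] at hw
  have : 0 < ∑ b, (Finsupp.single (f.1 b) 1 : ℕ →₀ ℕ) (f.1 x) :=
    Finset.sum_pos' (fun _ _ => Nat.zero_le _) ⟨x, Finset.mem_univ _, by simp⟩
  lia

theorem fillingSeries_congr {X Y : Type*} [Fintype X] [Fintype Y] (e : X ≃ Y)
    {Φ : (X → ℕ) → Prop} {Ψ : (Y → ℕ) → Prop} (h : ∀ f, Φ (f ∘ e) ↔ Ψ f) :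
    fillingSeries K Φ = fillingSeries K Ψ := by
  ext w
  rw [coeff_fillingSeries, coeff_fillingSeries]
  congr 1
  refine (Nat.card_congr ((Equiv.arrowCongr e (Equiv.refl ℕ)).symm.subtypeEquiv fun f => ?_)).symm
  have h2 : ∑ b, Finsupp.single (f (e b)) 1 = ∑ b, (Finsupp.single (f b) 1 : ℕ →₀ ℕ) :=
    Equiv.sum_comp e fun b => (Finsupp.single (f b) 1 : ℕ →₀ ℕ)
  rw [← h]
  change _ ↔ _ ∧ ∑ b, Finsupp.single (f (e b)) 1 = w
  rw [h2]
  rfl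

theorem fillingSeries_or {X : Type*} [Fintype X] {Φ Ψ₁ Ψ₂ : (X → ℕ) → Prop}
    (h : ∀ f, Φ f ↔ Ψ₁ f ∨ Ψ₂ f) (hd : ∀ f, Ψ₁ f → ¬ Ψ₂ f) :
    fillingSeries K Φ = fillingSeries K Ψ₁ + fillingSeries K Ψ₂ := by
  ext w
  rw [map_add, coeff_fillingSeries, coeff_fillingSeries, coeff_fillingSeries, ← Nat.cast_add]
  congr 1
  have := finite_fillings Ψ₁ w
  have := finite_fillings Ψ₂ w
  rw [← Nat.card_sum]
  refine (Nat.card_congr ((Equiv.subtypeEquivRight fun f => ?_).trans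
    (subtypeOrEquiv _ _ ?_)))
  · rw [h, or_and_right]
  · rw [Pi.disjoint_iff]
    exact fun f => Prop.disjoint_iff.2 (by have := hd f; tauto)

/-- A filling of the disjoint union is a pair of fillings, and its weight is the sum of theirs.
Allowing arbitrary finite sets and conditions avoids having to place the two factors in the plane.
-/
theorem fillingSeries_mul {X Y : Type*} [Fintype X] [Fintype Y] (Φ : (X → ℕ) → Prop)
    (Ψ : (Y → ℕ) → Prop) :
    fillingSeries K Φ * fillingSeries K Ψ =
      fillingSeries K fun f : X ⊕ Y → ℕ => Φ (f ∘ Sum.inl) ∧ Ψ (f ∘ Sum.inr) := by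
  ext w
  rw [MvPowerSeries.coeff_mul, coeff_fillingSeries]
  simp only [coeff_fillingSeries, ← Nat.cast_mul]
  rw [← Nat.cast_sum]
  congr 1
  have h1 : ∀ w, Finite {f : X → ℕ // Φ f ∧ ∑ b, Finsupp.single (f b) 1 = w} :=
    finite_fillings Φ
  have h2 : ∀ w, Finite {f : Y → ℕ // Ψ f ∧ ∑ b, Finsupp.single (f b) 1 = w} :=
    finite_fillings Ψ
  rw [← Finset.sum_coe_sort]
  simp only [← Nat.card_prod]
  rw [← Nat.card_sigma]
  refine Nat.card_congr
    { toFun := fun t => ⟨Sum.elim t.2.1.1 t.2.2.1, ⟨t.2.1.2.1, t.2.2.2.1⟩, ?_⟩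
      invFun := fun f => ⟨⟨(∑ b, Finsupp.single (f.1 (.inl b)) 1,
        ∑ b, Finsupp.single (f.1 (.inr b)) 1), ?_⟩,
        ⟨f.1 ∘ Sum.inl, f.2.1.1, rfl⟩, ⟨f.1 ∘ Sum.inr, f.2.1.2, rfl⟩⟩
      left_inv := ?_
      right_inv := ?_ }
  · have h3 := Finset.HasAntidiagonal.mem_antidiagonal.1 t.1.2
    rw [Fintype.sum_sum_type]
    exact (congrArg₂ (· + ·) t.2.1.2.2 t.2.2.2.2).trans h3
  · rw [Finset.HasAntidiagonal.mem_antidiagonal]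
    exact (Fintype.sum_sum_type _).symm.trans f.2.2
  · rintro ⟨⟨⟨w1, w2⟩, hw⟩, ⟨f, hf, h3⟩, ⟨g, hg, h4⟩⟩
    dsimp only at h3 h4
    subst h3 h4
    rfl
  · rintro ⟨f, hf⟩
    ext x
    rcases x with x | x <;> rfl

end FillingSeries

/-! ### Parallel infinite strips and convex sets of boxes -/

section Lines

/-- The number of elements of `D` less than `c`. -/
def upCount (D : Finset ℤ) (c : ℤ) : ℤ := ((D.filter fun e => e < c).card : ℤ)

theorem upCount_succ (D : Finset ℤ) (c : ℤ) :
    upCount D (c + 1) = upCount D c + if c ∈ D then 1 else 0 := by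
  unfold upCount
  split_ifs with h
  · have : D.filter (fun e => e < c + 1) = insert c (D.filter fun e => e < c) := by
      ext e; simp only [Finset.mem_filter, Finset.mem_insert]
      constructor
      · rintro ⟨h1, h2⟩
        by_cases h3 : e = c
        · exact .inl h3
        · exact .inr ⟨h1, by lia⟩
      · rintro (rfl | ⟨h1, h2⟩)
        · exact ⟨h, by lia⟩
        · exact ⟨h1, by lia⟩
    rw [this, Finset.card_insert_of_notMem (by simp)]
    simp
  · rw [add_zero]
    congr 2
    ext e; simp only [Finset.mem_filter, and_congr_right_iff]
    intro h1
    have : e ≠ c := fun h2 => h (h2 ▸ h1)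
    lia

theorem upCount_mono (D : Finset ℤ) {c c' : ℤ} (h : c ≤ c') : upCount D c ≤ upCount D c' := by
  induction c', h using Int.leInduction with
  | base => exact le_rfl
  | succ n _ ih => rw [upCount_succ]; split_ifs <;> lia

theorem sub_upCount_mono (D : Finset ℤ) {c c' : ℤ} (h : c ≤ c') :
    c - upCount D c ≤ c' - upCount D c' := by
  induction c', h using Int.leInduction with
  | base => exact le_rfl
  | succ n _ ih => rw [upCount_succ]; split_ifs <;> lia

/-- The box of content `c` on an infinite strip that goes up after the contents in `D` and right
after all others; `k` tells the parallel strips apart. -/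
def lineBox (D : Finset ℤ) (k c : ℤ) : Cell := (k - upCount D c, c + (k - upCount D c))

@[simp] theorem content_lineBox (D : Finset ℤ) (k c : ℤ) : content (lineBox D k c) = c := by
  simp [content, lineBox]

/-- The parallel strip to which a box belongs. -/
def lineKey (D : Finset ℤ) (b : Cell) : ℤ := b.1 + upCount D (content b)

@[simp] theorem lineKey_lineBox (D : Finset ℤ) (k c : ℤ) : lineKey D (lineBox D k c) = k := by
  simp [lineKey]
  simp [lineBox]

@[simp] theorem lineBox_lineKey (D : Finset ℤ) (b : Cell) :
    lineBox D (lineKey D b) (content b) = b := by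
  ext <;> simp [lineBox, lineKey, content]

theorem eq_lineBox {D : Finset ℤ} {b : Cell} {k c : ℤ} (h1 : lineKey D b = k)
    (h2 : content b = c) : b = lineBox D k c := by
  rw [← h1, ← h2, lineBox_lineKey]

theorem content_eq_iff {b : Cell} {c : ℤ} : content b = c ↔ b.2 = b.1 + c := by
  unfold content; lia

theorem lineBox_succ (D : Finset ℤ) (k c : ℤ) :
    lineBox D k (c + 1) = if c ∈ D then ((lineBox D k c).1 - 1, (lineBox D k c).2)
      else ((lineBox D k c).1, (lineBox D k c).2 + 1) := by
  unfold lineBox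
  rw [upCount_succ]
  split_ifs <;> ext <;> simp <;> lia

/-- Order-convexity of a set of boxes. -/
def BoxConvex (T : Finset Cell) : Prop :=
  ∀ x ∈ T, ∀ z ∈ T, ∀ y : Cell, x ≤ y → y ≤ z → y ∈ T

/-- After a translation into the positive quadrant, the outer shape is the lower closure of `T`, and
the inner shape consists of those of its boxes that do not lie above any box of `T` in the product
order. A box of the difference lies between two boxes of `T`, hence in `T` by convexity. -/
theorem BoxConvex.isSkewDiagram {T : Finset Cell} (h : BoxConvex T) : IsSkewDiagram T := by
  rcases T.eq_empty_or_nonempty with rfl | hT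
  · exact ⟨⊥, ⊥, 0, le_rfl, by simp [skewDiagram]⟩
  obtain ⟨v, hv⟩ : ∃ v : Cell, ∀ b ∈ T, v ≤ b := by
    -- A common lower bound is an upper bound in the order dual.
    obtain ⟨M, hM⟩ := Finset.exists_le (α := Cellᵒᵈ) (T.map OrderDual.toDual.toEmbedding)
    exact ⟨M.ofDual, fun b hb => hM (OrderDual.toDual b) (by simpa using hb)⟩
  set up : Cell → ℕ × ℕ := fun b => ((b.1 - v.1).toNat, (b.2 - v.2).toNat) with hup
  have cast1 : ∀ b ∈ T, ((up b).1 : ℤ) = b.1 - v.1 ∧ ((up b).2 : ℤ) = b.2 - v.2 := fun b hb => by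
    have h1 := (hv b hb).1
    have h2 := (hv b hb).2
    simp only [hup]; lia
  let lam : YoungDiagram :=
    { cells := T.biUnion fun b => Finset.Iic (up b)
      isLowerSet := by
        intro x y hyx hx
        simp only [Finset.coe_biUnion, Set.mem_iUnion, Finset.mem_coe, Finset.mem_Iic] at hx ⊢
        obtain ⟨b, hb, hx⟩ := hx
        exact ⟨b, hb, hyx.trans hx⟩ }
  have mem_lam : ∀ x, x ∈ lam.cells ↔ ∃ b ∈ T, x ≤ up b := fun x => by
    simp only [lam, Finset.mem_biUnion, Finset.mem_Iic]
  let mu : YoungDiagram :=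
    { cells := lam.cells.filter fun x => ∀ b ∈ T, ¬ up b ≤ x
      isLowerSet := by
        intro x y hyx hx
        simp only [Finset.coe_filter, Set.mem_ofPred_eq] at hx ⊢
        exact ⟨lam.isLowerSet hyx hx.1, fun b hb hb' => hx.2 b hb (hb'.trans hyx)⟩ }
  refine ⟨lam, mu, v, fun x hx => (Finset.mem_filter.1 hx).1, ?_⟩
  ext y
  have hmu : ∀ x, x ∈ mu.cells ↔ x ∈ lam.cells ∧ ∀ b ∈ T, ¬ up b ≤ x := fun x => by
    simp only [mu, Finset.mem_filter]
  simp only [skewDiagram, Finset.mem_image, Finset.mem_sdiff, exists_exists_and_eq_and, hmu,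
    mem_lam]
  constructor
  · intro hy
    refine ⟨up y, ⟨⟨y, hy, le_rfl⟩, fun h1 => h1.2 y hy le_rfl⟩, ?_⟩
    obtain ⟨h1, h2⟩ := cast1 y hy
    ext <;> simp <;> lia
  · rintro ⟨x, ⟨⟨z, hz, hxz⟩, hx2⟩, rfl⟩
    have : ∃ b ∈ T, up b ≤ x := by
      by_contra! h3
      exact hx2 ⟨⟨z, hz, hxz⟩, h3⟩
    obtain ⟨b, hb, hbx⟩ := this
    obtain ⟨h1, h2⟩ := cast1 b hb
    obtain ⟨h3, h4⟩ := cast1 z hz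
    have h5 := hbx.1
    have h6 := hbx.2
    have h7 := hxz.1
    have h8 := hxz.2
    refine h b hb z hz _ ⟨?_, ?_⟩ ⟨?_, ?_⟩ <;> simp <;> lia

/-- Along the strip rows weakly decrease and columns weakly increase, so two boxes of it that are
comparable in the product order share a row or a column, and the strip is straight between them. -/
theorem lineBox_between {D : Finset ℤ} {k c c' : ℤ} {y : Cell} (h1 : lineBox D k c ≤ y)
    (h2 : y ≤ lineBox D k c') :
    y = lineBox D k (content y) ∧ content y ∈ Set.uIcc c c' := by
  have h1a : k - upCount D c ≤ y.1 := h1.1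
  have h1b : c + (k - upCount D c) ≤ y.2 := h1.2
  have h2a : y.1 ≤ k - upCount D c' := h2.1
  have h2b : y.2 ≤ c' + (k - upCount D c') := h2.2
  have key : content y ∈ Set.uIcc c c' ∧ y.1 = k - upCount D (content y) := by
    have hy : content y = y.2 - y.1 := rfl
    rcases le_total c c' with h | h
    · have h3 := upCount_mono D h
      have h4 : c ≤ content y := by lia
      have h5 : content y ≤ c' := by lia
      have h6 := upCount_mono D h4
      have h7 := upCount_mono D h5
      exact ⟨Set.mem_uIcc.2 (.inl ⟨h4, h5⟩), by lia⟩
    · have h3 := sub_upCount_mono D h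
      have h4 : c' ≤ content y := by lia
      have h5 : content y ≤ c := by lia
      have h6 := sub_upCount_mono D h4
      have h7 := sub_upCount_mono D h5
      exact ⟨Set.mem_uIcc.2 (.inr ⟨h4, h5⟩), by lia⟩
  refine ⟨Prod.ext key.2 ?_, key.1⟩
  have := key.2
  simp only [lineBox, content] at *
  lia

theorem boxConvex_lineBox (D : Finset ℤ) (k p q : ℤ) :
    BoxConvex ((Finset.Icc p q).image (lineBox D k)) := by
  intro x hx z hz y hxy hyz
  simp only [Finset.mem_image, Finset.mem_Icc] at *
  obtain ⟨c, hc, rfl⟩ := hx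
  obtain ⟨c', hc', rfl⟩ := hz
  obtain ⟨h1, h2⟩ := lineBox_between hxy hyz
  refine ⟨content y, ?_, h1.symm⟩
  rcases Set.mem_uIcc.1 h2 with h | h <;> lia

end Lines

/-! ### Schur functions of segments and the gluing identity -/

section SegmentSeries

/-- The condition on the entries `m`, `n` of two consecutive boxes of a strip that goes up or
right in between. -/
def StepRel (up : Prop) (m n : ℕ) : Prop := if up then n < m else m ≤ n

/-- Semistandardness of a filling of a segment of a strip, the boxes being given by their
contents. -/
def IsSegmentFilling (D : Finset ℤ) (p q : ℤ) (f : Finset.Icc p q → ℕ) : Prop :=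
  ∀ (c : ℤ) (h1 : p ≤ c) (h2 : c + 1 ≤ q),
    StepRel (c ∈ D) (f ⟨c, Finset.mem_Icc.2 ⟨h1, by lia⟩⟩)
      (f ⟨c + 1, Finset.mem_Icc.2 ⟨by lia, h2⟩⟩)

theorem lineBox_injective (D : Finset ℤ) (k : ℤ) : Function.Injective (lineBox D k) := fun c c' h => by
  simpa using congrArg content h

theorem mem_of_upCount_eq {D : Finset ℤ} {c c' : ℤ} (h : c < c')
    (hD : c' - upCount D c' = c - upCount D c) :
    c ∈ D ∧ (c + 1) - upCount D (c + 1) = c' - upCount D c' := by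
  have h1 := sub_upCount_mono D (show c + 1 ≤ c' by lia)
  have h2 := upCount_succ D c
  split_ifs at h2 with h3
  · exact ⟨h3, by lia⟩
  · lia

theorem notMem_of_upCount_eq {D : Finset ℤ} {c c' : ℤ} (h : c < c')
    (hD : upCount D c' = upCount D c) :
    c ∉ D ∧ upCount D (c + 1) = upCount D c' := by
  have h1 := upCount_mono D (show c + 1 ≤ c' by lia)
  have h2 := upCount_succ D c
  split_ifs at h2 with h3
  · lia
  · exact ⟨h3, by lia⟩

/-- Equal values of `upCount` mean equal rows, so every step in between goes right and the
inequalities between neighbours can be chained. This and `IsSegmentFilling.lt_of_col` reduce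
semistandardness to consecutive boxes. -/
theorem IsSegmentFilling.le_of_row {D : Finset ℤ} {p q : ℤ} {f : Finset.Icc p q → ℕ}
    (hf : IsSegmentFilling D p q f) (n : ℕ) : ∀ (c c' : Finset.Icc p q), c.1 + n = c'.1 →
    upCount D c'.1 = upCount D c.1 → f c ≤ f c' := by
  induction n with
  | zero =>
    intro c c' h _
    rw [show c = c' from Subtype.ext (by simpa using h)]
  | succ n ih =>
    rintro ⟨c, hc⟩ ⟨c', hc'⟩ h hD
    simp only at h hD
    have h1 := Finset.mem_Icc.1 hc
    have h2 := Finset.mem_Icc.1 hc'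
    obtain ⟨h3, h4⟩ := notMem_of_upCount_eq (by lia) hD
    have h5 := hf c h1.1 (by lia)
    rw [StepRel, if_neg h3] at h5
    exact h5.trans (ih _ _ (by simp only; push_cast at h; lia) h4.symm)

theorem IsSegmentFilling.lt_of_col {D : Finset ℤ} {p q : ℤ} {f : Finset.Icc p q → ℕ}
    (hf : IsSegmentFilling D p q f) (n : ℕ) : ∀ (c c' : Finset.Icc p q), c.1 + (n + 1) = c'.1 →
    c'.1 - upCount D c'.1 = c.1 - upCount D c.1 → f c' < f c := by
  induction n with
  | zero =>
    rintro ⟨c, hc⟩ ⟨c', hc'⟩ h hD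
    simp only [Nat.cast_zero, zero_add] at h hD
    subst h
    have h1 := Finset.mem_Icc.1 hc
    have h2 := Finset.mem_Icc.1 hc'
    have h5 := hf c h1.1 h2.2
    rwa [StepRel, if_pos (mem_of_upCount_eq (by lia) hD).1] at h5
  | succ n ih =>
    rintro ⟨c, hc⟩ ⟨c', hc'⟩ h hD
    simp only at h hD
    have h1 := Finset.mem_Icc.1 hc
    have h2 := Finset.mem_Icc.1 hc'
    obtain ⟨h3, h4⟩ := mem_of_upCount_eq (by lia) hD
    have h5 := hf c h1.1 (by lia)
    rw [StepRel, if_pos h3] at h5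
    exact (ih _ _ (by simp only; push_cast at h; lia) h4.symm).trans h5

variable (K : Type*) [CommRing K]

theorem skewSchur_lineBox (D : Finset ℤ) (k p q : ℤ) :
    skewSchur K ((Finset.Icc p q).image (lineBox D k)) =
      fillingSeries K (IsSegmentFilling D p q) := by
  let e : Finset.Icc p q ≃ (Finset.Icc p q).image (lineBox D k) :=
    Equiv.ofBijective
      (fun c => ⟨lineBox D k c.1, Finset.mem_image_of_mem _ c.2⟩)
      ⟨fun c c' h => Subtype.ext (lineBox_injective D k (congrArg Subtype.val h)),
        fun ⟨b, hb⟩ => by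
          obtain ⟨c, hc, rfl⟩ := Finset.mem_image.1 hb
          exact ⟨⟨c, hc⟩, rfl⟩⟩
  rw [skewSchur_eq_fillingSeries]
  refine (fillingSeries_congr K e fun f => ?_).symm
  have he : ∀ c, (e c).1 = (k - upCount D c.1, c.1 + (k - upCount D c.1)) := fun c => rfl
  constructor
  · intro hf
    constructor
    · intro b c h1 h2
      obtain ⟨b, rfl⟩ := e.surjective b
      obtain ⟨c, rfl⟩ := e.surjective c
      simp only [he] at h1 h2
      exact hf.le_of_row (c.1 - b.1).toNat b c (by lia) (by lia)
    · intro b c h1 h2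
      obtain ⟨b, rfl⟩ := e.surjective b
      obtain ⟨c, rfl⟩ := e.surjective c
      simp only [he] at h1 h2
      exact hf.lt_of_col (b.1 - c.1 - 1).toNat c b (by lia) (by lia)
  · intro hf c h1 h2
    have h3 := upCount_succ D c
    unfold StepRel
    split_ifs at h3 ⊢ with h4
    · refine hf.2 _ _ ?_ ?_ <;> simp only [he] <;> lia
    · refine hf.1 _ _ ?_ ?_ <;> simp only [he] <;> lia

/-- The Schur function of a segment of a strip with directions `D`, with the same conventions as
in `segmentSchur`. -/
def segmentSeries (D : Finset ℤ) (p q : ℤ) : MvPowerSeries ℕ K :=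
  if p ≤ q then fillingSeries K (IsSegmentFilling D p q) else if p = q + 1 then 1 else 0

theorem segmentSeries_mem (D : Finset ℤ) (p q : ℤ) :
    segmentSeries K D p q ∈ symmetricFunctions K := by
  unfold segmentSeries
  split_ifs
  · rw [← skewSchur_lineBox K D 0]
    exact Algebra.subset_adjoin ⟨_, (boxConvex_lineBox D 0 p q).isSkewDiagram, rfl⟩
  · exact one_mem _
  · exact zero_mem _

theorem segmentSeries_congr {D D' : Finset ℤ} {p q : ℤ}
    (h : ∀ c, p ≤ c → c < q → (c ∈ D ↔ c ∈ D')) : segmentSeries K D p q = segmentSeries K D' p q := by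
  unfold segmentSeries
  congr 1
  refine fillingSeries_congr K (Equiv.refl _) fun f => ?_
  refine forall_congr' fun c => forall_congr' fun h1 => forall_congr' fun h2 => ?_
  rw [propext (h c h1 (by lia))]
  rfl

/-- Splitting an interval of contents after `i`. -/
def splitIcc {p i q : ℤ} (h1 : p ≤ i) (h2 : i < q) :
    Finset.Icc p i ⊕ Finset.Icc (i + 1) q ≃ Finset.Icc p q where
  toFun := Sum.elim
    (fun c => ⟨c.1, by have := Finset.mem_Icc.1 c.2; exact Finset.mem_Icc.2 (by lia)⟩)
    (fun c => ⟨c.1, by have := Finset.mem_Icc.1 c.2; exact Finset.mem_Icc.2 (by lia)⟩)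
  invFun c := if h : c.1 ≤ i
    then .inl ⟨c.1, Finset.mem_Icc.2 ⟨(Finset.mem_Icc.1 c.2).1, h⟩⟩
    else .inr ⟨c.1, Finset.mem_Icc.2 ⟨by lia, (Finset.mem_Icc.1 c.2).2⟩⟩
  left_inv := by
    rintro (⟨c, hc⟩ | ⟨c, hc⟩)
    · simp [(Finset.mem_Icc.1 hc).2]
    · have := (Finset.mem_Icc.1 hc).1
      simp [show ¬ c ≤ i by lia]
  right_inv := by
    rintro ⟨c, hc⟩
    by_cases h : c ≤ i <;> simp [h]

/-- A pair of fillings of the two pieces satisfies all conditions of a filling of `[p, q]` except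
the one between `i` and `i + 1`. There the two entries satisfy exactly one of `m ≤ n` and `n < m`,
the conditions for a step right and for a step up; one of these belongs to `D` and the other to
`D'`. -/
theorem segmentSeries_mul {D D' : Finset ℤ} {p i q : ℤ} (h1 : p ≤ i) (h2 : i < q)
    (hi : i ∈ D ↔ i ∉ D') (hD : ∀ c, c ≠ i → (c ∈ D ↔ c ∈ D')) :
    segmentSeries K D p i * segmentSeries K D (i + 1) q =
      segmentSeries K D p q + segmentSeries K D' p q := by
  unfold segmentSeries
  rw [if_pos h1, if_pos (show i + 1 ≤ q by lia), if_pos (show p ≤ q by lia),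
    if_pos (show p ≤ q by lia), fillingSeries_mul]
  rw [← fillingSeries_or K (Φ := fun f : Finset.Icc p q → ℕ =>
    ∀ (c : ℤ) (h1 : p ≤ c) (h2 : c + 1 ≤ q), c ≠ i →
    StepRel (c ∈ D) (f ⟨c, Finset.mem_Icc.2 ⟨h1, by lia⟩⟩)
      (f ⟨c + 1, Finset.mem_Icc.2 ⟨by lia, h2⟩⟩))]
  · refine fillingSeries_congr K (splitIcc h1 h2) fun f => ?_
    constructor
    · rintro ⟨hl, hr⟩ c hc1 hc2 hc3
      rcases lt_or_gt_of_ne hc3 with hc4 | hc4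
      · exact hl c hc1 (by lia)
      · exact hr c (by lia) hc2
    · intro hf
      exact ⟨fun c hc1 hc2 => hf c hc1 (by lia) (by lia),
        fun c hc1 hc2 => hf c (by lia) hc2 (by lia)⟩
  · intro f
    constructor
    · intro hf
      by_cases h3 : StepRel (i ∈ D) (f ⟨i, Finset.mem_Icc.2 ⟨h1, by lia⟩⟩)
        (f ⟨i + 1, Finset.mem_Icc.2 ⟨by lia, by lia⟩⟩)
      · left
        intro c hc1 hc2
        by_cases hc : c = i
        · subst hc; exact h3
        · exact hf c hc1 hc2 hc
      · right
        intro c hc1 hc2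
        by_cases hc : c = i
        · subst hc
          unfold StepRel at h3 ⊢
          simp only [hi] at h3
          split_ifs at h3 ⊢ <;> lia
        · have := hf c hc1 hc2 hc
          rwa [propext (hD c hc)] at this
    · rintro (hf | hf) c hc1 hc2 hc3
      · exact hf c hc1 hc2
      · have := hf c hc1 hc2
        rwa [← propext (hD c hc3)] at this
  · intro f hf hf'
    have h3 := hf i h1 (by lia)
    have h4 := hf' i h1 (by lia)
    unfold StepRel at h3 h4
    simp only [hi] at h3
    split_ifs at h3 h4 <;> lia

end SegmentSeries

/-! ### Connected skew shapes and border strips -/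

section Shape

/-- The box on top of `b`. -/
def aboveBox (b : Cell) : Cell := (b.1 - 1, b.2)

/-- The box to the right of `b`. -/
def rightBox (b : Cell) : Cell := (b.1, b.2 + 1)

@[simp] theorem content_aboveBox (b : Cell) : content (aboveBox b) = content b + 1 := by
  simp only [content, aboveBox]; ring

@[simp] theorem content_rightBox (b : Cell) : content (rightBox b) = content b + 1 := by
  simp only [content, rightBox]; ring

theorem aboveBox_ne_rightBox (b : Cell) : aboveBox b ≠ rightBox b := by
  intro h
  have := congrArg Prod.fst h
  simp [aboveBox, rightBox] at this

theorem mem_diagonals {S : Finset Cell} {b : Cell} (h : b ∈ S) : content b ∈ diagonals S :=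
  Finset.mem_image_of_mem _ h

theorem IsSkewDiagram.boxConvex {T : Finset Cell} (h : IsSkewDiagram T) : BoxConvex T := by
  obtain ⟨lam, mu, v, -, rfl⟩ := h
  intro x hx z hz y hxy hyz
  simp only [skewDiagram, Finset.mem_image, exists_exists_and_eq_and, Finset.mem_sdiff] at *
  obtain ⟨a, ⟨-, ha2⟩, rfl⟩ := hx
  obtain ⟨c, ⟨hc1, -⟩, rfl⟩ := hz
  have h1 := hxy.1
  have h2 := hxy.2
  have h3 := hyz.1
  have h4 := hyz.2
  simp only [Prod.fst_add, Prod.snd_add] at h1 h2 h3 h4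
  refine ⟨((y.1 - v.1).toNat, (y.2 - v.2).toNat), ⟨?_, fun h5 => ha2 ?_⟩, ?_⟩
  · exact lam.isLowerSet ⟨by simp only; lia, by simp only; lia⟩ hc1
  · exact mu.isLowerSet ⟨by simp only; lia, by simp only; lia⟩ h5
  · ext <;> simp <;> lia

theorem skewDiagram_boxConvex (lam mu : YoungDiagram) (h : mu ≤ lam) :
    BoxConvex (skewDiagram lam mu) :=
  IsSkewDiagram.boxConvex ⟨lam, mu, 0, h, by simp⟩

variable {S T : Finset Cell}

/-- Adjacent boxes have contents that differ by one, so a path from `b` to `b'` has to cross from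
content `c` to content `c + 1`, going up or right. -/
theorem IsEdgeConnected.exists_crossing (h : IsEdgeConnected T) {b b' : Cell} (hb : b ∈ T)
    (hb' : b' ∈ T) {c : ℤ} (h1 : content b ≤ c) (h2 : c < content b') :
    ∃ x ∈ T, content x = c ∧ (aboveBox x ∈ T ∨ rightBox x ∈ T) := by
  obtain ⟨w⟩ := h.preconnected ⟨b, hb⟩ ⟨b', hb'⟩
  obtain ⟨d, -, hd1, hd2⟩ := w.exists_boundary_dart {x | content x.1 ≤ c} h1 (not_le.2 h2)
  have hadj := d.adj
  simp only [SimpleGraph.comap_adj, cellGraph, SimpleGraph.fromRel_adj] at hadj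
  change content d.fst.1 ≤ c at hd1
  change ¬ content d.snd.1 ≤ c at hd2
  have h3 := d.snd.2
  rcases hadj.2 with (h4 | h4) | (h4 | h4)
  · have h5 : d.snd.1 = rightBox d.fst.1 := h4
    have h6 := content_rightBox d.fst.1
    exact ⟨d.fst.1, d.fst.2, by rw [h5] at hd2; lia, .inr (h5 ▸ h3)⟩
  · have h5 : d.snd.1 = aboveBox d.fst.1 := h4
    have h6 := content_aboveBox d.fst.1
    exact ⟨d.fst.1, d.fst.2, by rw [h5] at hd2; lia, .inl (h5 ▸ h3)⟩
  · have h5 : d.fst.1 = rightBox d.snd.1 := h4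
    have h6 := content_rightBox d.snd.1
    rw [h5] at hd1; lia
  · have h5 : d.fst.1 = aboveBox d.snd.1 := h4
    have h6 := content_aboveBox d.snd.1
    rw [h5] at hd1; lia

theorem IsEdgeConnected.mem_diagonals (h : IsEdgeConnected T) {p q c : ℤ} (hp : p ∈ diagonals T)
    (hq : q ∈ diagonals T) (h1 : p ≤ c) (h2 : c ≤ q) : c ∈ diagonals T := by
  rcases h2.eq_or_lt with rfl | h2
  · exact hq
  obtain ⟨b, hb, rfl⟩ := Finset.mem_image.1 hp
  obtain ⟨b', hb', rfl⟩ := Finset.mem_image.1 hq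
  obtain ⟨x, hx, rfl, -⟩ := h.exists_crossing hb hb' h1 h2
  exact _root_.mem_diagonals hx

/-- Connectedness yields a crossing at some box `x` of the same content as `b`. If `x` is higher up
on the diagonal, the box above `b` lies between the successor of `x` and `b`; if `x` is lower, the
box to the right of `b` lies between `b` and the successor of `x`. Convexity does the rest. -/
theorem IsEdgeConnected.exists_next (h : IsEdgeConnected T) (hT : BoxConvex T) {b b' : Cell}
    (hb : b ∈ T) (hb' : b' ∈ T) (hbb : content b < content b') :
    aboveBox b ∈ T ∨ rightBox b ∈ T := by
  obtain ⟨x, hx, hxc, hx'⟩ := h.exists_crossing hb hb' le_rfl hbb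
  simp only [content] at hxc
  simp only [aboveBox, rightBox] at *
  rcases lt_trichotomy x.1 b.1 with h1 | h1 | h1
  · left
    rcases hx' with hx' | hx'
    · exact hT _ hx' _ hb _ ⟨by simp only; lia, by simp only; lia⟩ ⟨by simp only; lia, le_rfl⟩
    · exact hT _ hx' _ hb _ ⟨by simp only; lia, by simp only; lia⟩ ⟨by simp only; lia, le_rfl⟩
  · rwa [show b = x from Prod.ext h1.symm (by lia)]
  · right
    rcases hx' with hx' | hx'
    · exact hT _ hb _ hx' _ ⟨le_rfl, by simp only; lia⟩ ⟨by simp only; lia, by simp only; lia⟩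
    · exact hT _ hb _ hx' _ ⟨le_rfl, by simp only; lia⟩ ⟨by simp only; lia, by simp only; lia⟩

theorem IsEdgeConnected.exists_prev (h : IsEdgeConnected T) (hT : BoxConvex T) {b b' : Cell}
    (hb : b ∈ T) (hb' : b' ∈ T) (hbb : content b' < content b) :
    ∃ x ∈ T, b = aboveBox x ∨ b = rightBox x := by
  obtain ⟨x, hx, hxc, hx'⟩ := h.exists_crossing (c := content b - 1) hb' hb (by lia) (by lia)
  simp only [content] at hxc
  simp only [aboveBox, rightBox] at *
  rcases lt_trichotomy x.1 b.1 with h1 | h1 | h1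
  · refine ⟨(b.1, b.2 - 1), ?_, .inr (by ext <;> simp)⟩
    exact hT _ hx _ hb _ ⟨by simp only; lia, by simp only; lia⟩ ⟨le_rfl, by simp only; lia⟩
  · exact ⟨x, hx, .inr (Prod.ext (by simp only; lia) (by simp only; lia))⟩
  · refine ⟨(b.1 + 1, b.2), ?_, .inl (by ext <;> simp)⟩
    exact hT _ hb _ hx _ ⟨by simp only; lia, le_rfl⟩ ⟨by simp only; lia, by simp only; lia⟩

theorem BoxConvex.rightBox_mem (hT : BoxConvex T) {b b' : Cell} (hb : b ∈ T) (hb' : b' ∈ T)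
    (h1 : b.1 < b'.1) (h2 : b.2 < b'.2) : rightBox b ∈ T :=
  hT _ hb _ hb' _ ⟨le_rfl, by simp [rightBox]⟩ ⟨h1.le, by simp only [rightBox]; lia⟩

/-- Two different boxes on one diagonal would force, by convexity, the `2 × 2` block whose upper
left box is the upper one of the two. -/
theorem IsStrip.content_injOn (h : IsStrip T) {b b' : Cell} (hb : b ∈ T) (hb' : b' ∈ T)
    (hc : content b = content b') : b = b' := by
  have hT := h.1.boxConvex
  have key : ∀ b ∈ T, ∀ b' ∈ T, content b = content b' → ¬ b.1 < b'.1 := by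
    intro b hb b' hb' hc hlt
    simp only [content] at hc
    refine h.2.2 b.1 b.2 ⟨hb, ?_, ?_, ?_⟩ <;>
      exact hT _ hb _ hb' _ ⟨by simp, by simp⟩ ⟨by simp only; lia, by simp only; lia⟩
  have h1 := key b hb b' hb' hc
  have h2 := key b' hb' b hb hc.symm
  simp only [content] at hc
  ext <;> lia

theorem content_le_endContent {b : Cell} (hb : b ∈ T) : content b ≤ endContent T :=
  le_csSup (T.finite_toSet.image _).bddAbove ⟨b, hb, rfl⟩

theorem startContent_le_content {b : Cell} (hb : b ∈ T) : startContent T ≤ content b :=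
  csInf_le (T.finite_toSet.image _).bddBelow ⟨b, hb, rfl⟩

theorem exists_content_eq_endContent (hT : T.Nonempty) : ∃ b ∈ T, content b = endContent T := by
  have := Set.Nonempty.csSup_mem (Set.Nonempty.image content hT) (T.finite_toSet.image _)
  exact this

theorem exists_content_eq_startContent (hT : T.Nonempty) :
    ∃ b ∈ T, content b = startContent T := by
  have := Set.Nonempty.csInf_mem (Set.Nonempty.image content hT) (T.finite_toSet.image _)
  exact this

theorem isEndBox_iff {b : Cell} : IsEndBox T b ↔ b ∈ T ∧ content b = endContent T := by
  constructor
  · rintro ⟨h1, h2⟩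
    obtain ⟨c, hc, hc'⟩ := exists_content_eq_endContent ⟨b, h1⟩
    exact ⟨h1, le_antisymm (content_le_endContent h1) (hc' ▸ h2 c hc)⟩
  · rintro ⟨h1, h2⟩
    exact ⟨h1, fun c hc => h2 ▸ content_le_endContent hc⟩

theorem onTop_iff {b : Cell} : OnTop S b ↔ aboveBox b ∉ S :=
  ⟨fun h h' => h _ h' rfl, fun h c hc hc' => h (by rw [IsAbove] at hc'; rwa [hc'] at hc)⟩

theorem onRight_iff {b : Cell} : OnRight S b ↔ rightBox b ∉ S :=
  ⟨fun h h' => h _ h' rfl, fun h c hc hc' => h (by rw [IsRightOf] at hc'; rwa [hc'] at hc)⟩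

end Shape

/-! ### Directions of diagonals; a decomposition is determined by them -/

section Directions

variable {S : Finset Cell} (P : OutsideDecomposition S)

theorem OutsideDecomposition.part_isStrip {b : Cell} (hb : b ∈ S) : IsStrip (P.part b) :=
  P.isStrip _ (P.part_mem.2 hb)

theorem OutsideDecomposition.eq_of_mem_part {b c c' : Cell} (hc : c ∈ P.part b)
    (hc' : c' ∈ P.part b) (h : content c = content c') : c = c' := by
  have hb : b ∈ S := P.part_nonempty.1 ⟨c, hc⟩
  exact (P.part_isStrip hb).content_injOn hc hc' h

theorem OutsideDecomposition.part_eq_of_mem_part {b c : Cell} (hc : c ∈ P.part b) :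
    P.part c = P.part b :=
  P.part_eq_of_mem (P.part_mem.2 (P.part_nonempty.1 ⟨c, hc⟩)) hc

theorem goesUp_iff {b : Cell} (hb : b ∈ S) :
    GoesUp P b ↔ aboveBox b ∈ P.part b ∨ (IsEndBox (P.part b) b ∧ aboveBox b ∉ S) := by
  constructor
  · rintro ⟨T, hT, hbT, h⟩
    rw [P.part_eq_of_mem hT hbT]
    rcases h with ⟨c, hc, rfl⟩ | ⟨h1, h2⟩
    · exact .inl hc
    · exact .inr ⟨h1, onTop_iff.1 h2⟩
  · intro h
    refine ⟨P.part b, P.part_mem.2 hb, P.mem_part_self.2 hb, ?_⟩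
    rcases h with h | ⟨h1, h2⟩
    · exact .inl ⟨_, h, rfl⟩
    · exact .inr ⟨h1, onTop_iff.2 h2⟩

theorem goesRight_iff {b : Cell} (hb : b ∈ S) :
    GoesRight P b ↔ rightBox b ∈ P.part b ∨
      (IsEndBox (P.part b) b ∧ rightBox b ∉ S ∧ aboveBox b ∈ S) := by
  constructor
  · rintro ⟨T, hT, hbT, h⟩
    rw [P.part_eq_of_mem hT hbT]
    rcases h with ⟨c, hc, rfl⟩ | ⟨h1, h2, h3⟩
    · exact .inl hc
    · rw [onTop_iff, not_not] at h3
      exact .inr ⟨h1, onRight_iff.1 h2, h3⟩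
  · intro h
    refine ⟨P.part b, P.part_mem.2 hb, P.mem_part_self.2 hb, ?_⟩
    rcases h with h | ⟨h1, h2, h3⟩
    · exact .inl ⟨_, h, rfl⟩
    · exact .inr ⟨h1, onRight_iff.2 h2, by rwa [onTop_iff, not_not]⟩

theorem GoesUp.not_goesRight {b : Cell} (hb : b ∈ S) (h : GoesUp P b) : ¬ GoesRight P b := by
  rw [goesUp_iff P hb] at h
  rw [goesRight_iff P hb]
  rintro (h1 | ⟨h1, h2, h3⟩)
  · rcases h with h | ⟨h4, h5⟩
    · exact aboveBox_ne_rightBox b (P.eq_of_mem_part h h1 (by simp))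
    · have := h4.2 _ h1
      simp at this
  · rcases h with h | ⟨h4, h5⟩
    · have := h1.2 _ h
      simp at this
    · exact h5 h3

theorem goesUp_or_goesRight {b : Cell} (hb : b ∈ S) : GoesUp P b ∨ GoesRight P b := by
  rw [goesUp_iff P hb, goesRight_iff P hb]
  have hs := P.part_isStrip hb
  have hbm := P.mem_part_self.2 hb
  rcases (content_le_endContent hbm).lt_or_eq with h | h
  · obtain ⟨c, hc, hc'⟩ := exists_content_eq_endContent ⟨b, hbm⟩
    have := hs.2.1.exists_next hs.1.boxConvex hbm hc (by rwa [hc'])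
    tauto
  · have hend := isEndBox_iff.2 ⟨hbm, h⟩
    have := P.end_mem _ (P.part_mem.2 hb) b hend
    rw [onTop_iff, onRight_iff] at this
    tauto

/-- Both boxes compete for the box `v` to the right of `b` and above `b'`, which lies in `S` by
convexity. If `b` goes up and `b'` does not, no box precedes `v` in its strip, but `v` is on neither
the left nor the bottom perimeter. If `b` goes right and `b'` goes up, both lie in the strip of `v`,
although they have the same content. -/
theorem goesUp_congr_succ (hS : BoxConvex S) {b b' : Cell} (hb : b ∈ S) (hb' : b' ∈ S)
    (h1 : b'.1 = b.1 + 1) (h2 : b'.2 = b.2 + 1) : GoesUp P b ↔ GoesUp P b' := by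
  have hv : aboveBox b' = rightBox b := by
    ext <;> simp [aboveBox, rightBox] <;> lia
  have hvS : rightBox b ∈ S := hS.rightBox_mem hb hb' (by lia) (by lia)
  constructor
  · intro hup
    by_contra hup'
    rw [goesUp_iff P hb] at hup
    rw [goesUp_iff P hb', hv] at hup'
    push Not at hup'
    have hs := P.part_isStrip hvS
    have hvm := P.mem_part_self.2 hvS
    have hstart : IsStartBox (P.part (rightBox b)) (rightBox b) := by
      refine ⟨hvm, fun c hc => ?_⟩
      by_contra! hlt
      obtain ⟨x, hx, hx' | hx'⟩ := hs.2.1.exists_prev hs.1.boxConvex hvm hc hlt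
      · have hxb : x = b' := by
          rw [← hv] at hx'
          simp only [aboveBox, Prod.mk.injEq] at hx'
          ext <;> lia
        rw [hxb] at hx
        exact hup'.1 (by rwa [P.part_eq_of_mem_part hx])
      · have hxb : x = b := by
          simp only [rightBox, Prod.mk.injEq] at hx'
          ext <;> lia
        rw [hxb] at hx
        rw [← P.part_eq_of_mem_part hx] at hvm
        rcases hup with hup | ⟨hup, -⟩
        · exact aboveBox_ne_rightBox b (P.eq_of_mem_part hup hvm (by simp))
        · have := hup.2 _ hvm
          simp at this
    rcases P.start_mem _ (P.part_mem.2 hvS) _ hstart with h | h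
    · exact h b hb rfl
    · exact h b' hb' hv.symm
  · intro hup
    refine (goesUp_or_goesRight P hb).resolve_right fun hr => ?_
    rw [goesUp_iff P hb', hv] at hup
    rw [goesRight_iff P hb] at hr
    have h3 : rightBox b ∈ P.part b' := by tauto
    have h4 : rightBox b ∈ P.part b := by tauto
    have h5 := P.part_eq_of_mem_part h3
    rw [P.part_eq_of_mem_part h4] at h5
    have h6 := P.mem_part_self.2 hb'
    rw [← h5] at h6
    have := P.eq_of_mem_part h6 (P.mem_part_self.2 hb) (by simp only [content]; lia)
    rw [this] at h1
    lia

theorem goesUp_congr (hS : BoxConvex S) {b b' : Cell} (hb : b ∈ S) (hb' : b' ∈ S)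
    (h : content b = content b') : GoesUp P b ↔ GoesUp P b' := by
  have key : ∀ n : ℕ, ∀ b ∈ S, ∀ b' ∈ S, content b = content b' → b.1 + n = b'.1 →
      (GoesUp P b ↔ GoesUp P b') := by
    intro n
    induction n with
    | zero =>
      intro b hb b' hb' h h1
      simp only [content] at h
      rw [show b = b' from Prod.ext (by simpa using h1) (by simp at h1; lia)]
    | succ n ih =>
      intro b hb b' hb' h h1
      simp only [content] at h
      push_cast at h1
      have hx : (b.1 + 1, b.2 + 1) ∈ S :=
        hS _ hb _ hb' _ ⟨by simp, by simp⟩ ⟨by simp only; lia, by simp only; lia⟩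
      exact (goesUp_congr_succ P hS hb hx rfl rfl).trans
        (ih _ hx _ hb' (by simp only [content]; lia) (by simp only; lia))
  rcases le_total b.1 b'.1 with h1 | h1
  · exact key (b'.1 - b.1).toNat b hb b' hb' h (by lia)
  · exact (key (b.1 - b'.1).toNat b' hb' b hb h.symm (by lia)).symm

/-- `D` is the set of the contents (except possibly the largest one) that go up with respect
to `P`. -/
def IsDirectionSet (D : Finset ℤ) : Prop :=
  ∀ b ∈ S, content b + 1 ∈ diagonals S →
    (GoesUp P b ↔ content b ∈ D) ∧ (GoesRight P b ↔ content b ∉ D)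

theorem isDirectionSet_filter (hS : BoxConvex S) :
    IsDirectionSet P ((diagonals S).filter fun c => DiagonalGoesUp P c) := by
  intro b hb _
  have h1 : GoesUp P b ↔ content b ∈ (diagonals S).filter fun c => DiagonalGoesUp P c := by
    rw [Finset.mem_filter]
    constructor
    · exact fun h => ⟨mem_diagonals hb, b, hb, rfl, h⟩
    · rintro ⟨-, b', hb', h1, h2⟩
      exact (goesUp_congr P hS hb hb' h1.symm).2 h2
  refine ⟨h1, ?_⟩
  rw [← h1]
  have h2 := goesUp_or_goesRight P hb
  have h3 := GoesUp.not_goesRight P hb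
  tauto

/-- The next box of the parallel strip to which `b` belongs. -/
def nextBox (D : Finset ℤ) (b : Cell) : Cell := lineBox D (lineKey D b) (content b + 1)

/-- The previous box of the parallel strip to which `b` belongs. -/
def prevBox (D : Finset ℤ) (b : Cell) : Cell := lineBox D (lineKey D b) (content b - 1)

@[simp] theorem content_nextBox (D : Finset ℤ) (b : Cell) :
    content (nextBox D b) = content b + 1 := by simp [nextBox]

@[simp] theorem content_prevBox (D : Finset ℤ) (b : Cell) :
    content (prevBox D b) = content b - 1 := by simp [prevBox]

@[simp] theorem nextBox_prevBox (D : Finset ℤ) (b : Cell) : nextBox D (prevBox D b) = b := by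
  simp [nextBox, prevBox]

@[simp] theorem prevBox_nextBox (D : Finset ℤ) (b : Cell) : prevBox D (nextBox D b) = b := by
  simp [nextBox, prevBox]

theorem nextBox_eq (D : Finset ℤ) (b : Cell) :
    nextBox D b = if content b ∈ D then aboveBox b else rightBox b := by
  rw [nextBox, lineBox_succ, lineBox_lineKey]
  rfl

variable {P} {D : Finset ℤ}

/-- An ending box is directed towards a neighbour outside `S`. So if the neighbour in the direction
of `b` lies in `S`, the strip of `b` does continue there. -/
theorem IsDirectionSet.nextBox_mem (h : IsDirectionSet P D) {b : Cell} (hb : b ∈ S)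
    (hn : nextBox D b ∈ S) : nextBox D b ∈ P.part b := by
  have h1 := h b hb (by simpa using mem_diagonals hn)
  rw [nextBox_eq] at hn ⊢
  split_ifs at hn ⊢ with hD
  · have := (goesUp_iff P hb).1 (h1.1.2 hD)
    tauto
  · have := (goesRight_iff P hb).1 (h1.2.2 hD)
    tauto

theorem IsDirectionSet.nextBox_mem_of_lt (h : IsDirectionSet P D) {b : Cell} (hb : b ∈ S)
    (hn : content b < endContent (P.part b)) : nextBox D b ∈ P.part b := by
  have hs := P.part_isStrip hb
  have hbm := P.mem_part_self.2 hb
  obtain ⟨c, hc, hc'⟩ := exists_content_eq_endContent ⟨b, hbm⟩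
  rcases hs.2.1.exists_next hs.1.boxConvex hbm hc (by rwa [hc']) with h1 | h1
  · have h2 := (goesUp_iff P hb).2 (.inl h1)
    have h3 := ((h b hb (by simpa using mem_diagonals (P.part_subset b h1))).1).1 h2
    rwa [nextBox_eq, if_pos h3]
  · have h2 := (goesRight_iff P hb).2 (.inl h1)
    have h3 := ((h b hb (by simpa using mem_diagonals (P.part_subset b h1))).2).1 h2
    rwa [nextBox_eq, if_neg h3]

theorem IsDirectionSet.nextBox_mem_iff (h : IsDirectionSet P D) {b : Cell} (hb : b ∈ S) :
    nextBox D b ∈ S ↔ content b < endContent (P.part b) := by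
  constructor
  · intro h1
    have := content_le_endContent (h.nextBox_mem hb h1)
    simp at this
    lia
  · exact fun h1 => P.part_subset b (h.nextBox_mem_of_lt hb h1)

theorem IsDirectionSet.prevBox_mem (h : IsDirectionSet P D) {b : Cell} (hb : b ∈ S)
    (hn : prevBox D b ∈ S) : prevBox D b ∈ P.part b := by
  have h1 := h.nextBox_mem hn (by simpa using hb)
  rw [nextBox_prevBox] at h1
  rw [P.part_eq_of_mem_part h1]
  exact P.mem_part_self.2 hn

theorem IsDirectionSet.prevBox_mem_iff (h : IsDirectionSet P D) {b : Cell} (hb : b ∈ S) :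
    prevBox D b ∈ S ↔ startContent (P.part b) < content b := by
  constructor
  · intro h1
    have := startContent_le_content (h.prevBox_mem hb h1)
    simp at this
    lia
  · intro h1
    have hs := P.part_isStrip hb
    have hbm := P.mem_part_self.2 hb
    obtain ⟨c, hc, hc'⟩ := exists_content_eq_startContent ⟨b, hbm⟩
    obtain ⟨x, hx, hx'⟩ := hs.2.1.exists_prev hs.1.boxConvex hbm hc (by rwa [hc'])
    have hxc : content x + 1 = content b := by rcases hx' with rfl | rfl <;> simp
    have hxS := P.part_subset b hx
    have h2 := P.part_eq_of_mem_part hx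
    have h3 := h.nextBox_mem_of_lt hxS (by
      rw [h2]; have := content_le_endContent hbm; lia)
    rw [h2] at h3
    have h4 := P.eq_of_mem_part h3 hbm (by simpa using hxc)
    rw [← h4, prevBox_nextBox]
    exact hxS

/-- Each step along a strip of `P` leads to a `nextBox` in `S`, and `Q` links a box to the same
`nextBox`. By symmetry the parts agree, which gives uniqueness of the twist. -/
theorem IsDirectionSet.part_subset (h : IsDirectionSet P D) {Q : OutsideDecomposition S}
    (h' : IsDirectionSet Q D) {b : Cell} (hb : b ∈ S) : P.part b ⊆ Q.part b := by
  have key : ∀ n : ℕ, ∀ x ∈ P.part b, ∀ y ∈ P.part b, content x + n = content y →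
      Q.part x = Q.part y := by
    intro n
    induction n with
    | zero =>
      intro x hx y hy hxy
      rw [P.eq_of_mem_part hx hy (by simpa using hxy)]
    | succ n ih =>
      intro x hx y hy hxy
      push_cast at hxy
      have hxS := P.part_subset b hx
      have h1 := P.part_eq_of_mem_part hx
      have h2 := h.nextBox_mem_of_lt hxS (by
        rw [h1]; have := content_le_endContent hy; lia)
      have h3 := h'.nextBox_mem hxS (P.part_subset x h2)
      rw [h1] at h2
      rw [← ih _ h2 y hy (by simp; lia), Q.part_eq_of_mem_part h3]
  intro y hy
  have hbm := P.mem_part_self.2 hb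
  have hyS := P.part_subset b hy
  have : Q.part b = Q.part y := by
    rcases le_total (content b) (content y) with h1 | h1
    · exact key (content y - content b).toNat b hbm y hy (by lia)
    · exact (key (content b - content y).toNat y hy b hbm (by lia)).symm
  rw [this]
  exact Q.mem_part_self.2 hyS

theorem IsDirectionSet.unique (h : IsDirectionSet P D) {Q : OutsideDecomposition S}
    (h' : IsDirectionSet Q D) : P = Q := by
  have hpart : ∀ b ∈ S, P.part b = Q.part b := fun b hb =>
    (h.part_subset h' hb).antisymm (h'.part_subset h hb)
  have h1 : ∀ P' Q' : OutsideDecomposition S, (∀ b ∈ S, P'.part b = Q'.part b) →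
      P'.parts ⊆ Q'.parts := by
    intro P' Q' hp T hT
    obtain ⟨b, hb⟩ := P'.nonempty_of_mem_parts hT
    have hbS := P'.subset hT hb
    rw [← P'.part_eq_of_mem hT hb, hp b hbS]
    exact Q'.part_mem.2 hbS
  have h2 : P.toFinpartition = Q.toFinpartition :=
    Finpartition.ext ((h1 P Q hpart).antisymm (h1 Q P fun b hb => (hpart b hb).symm))
  cases P; cases Q
  simp only at h2
  subst h2
  rfl

theorem IsDirectionSet.segmentSchur_eq (K : Type*) [CommRing K] (h : IsDirectionSet P D)
    (hS : BoxConvex S) (hconn : IsEdgeConnected S) {p q : ℤ} (hp : p ∈ diagonals S)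
    (hq : q ∈ diagonals S) : segmentSchur K P p q = segmentSeries K D p q := by
  have h0 := isDirectionSet_filter P hS
  have hc : ∀ c, cuttingBox P c =
      lineBox ((diagonals S).filter fun c => DiagonalGoesUp P c) 0 c := by
    intro c
    simp only [cuttingBox, lineBox, upCount, Finset.filter_filter, zero_sub]
    simp only [and_comm]
  -- `D` may differ from the actual set of upward contents at the largest content and outside the
  -- diagonals, but a segment ending at `q` only sees the directions of contents less than `q`.
  rw [show segmentSeries K D p q =
    segmentSeries K ((diagonals S).filter fun c => DiagonalGoesUp P c) p q from ?_]
  · unfold segmentSchur segmentSeries cuttingSegment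
    rw [← skewSchur_lineBox K _ 0, show cuttingBox P = _ from funext hc]
  · refine segmentSeries_congr K fun c h1 h2 => ?_
    obtain ⟨b, hb, rfl⟩ := Finset.mem_image.1 (hconn.mem_diagonals hp hq h1 h2.le)
    have h3 := hconn.mem_diagonals (c := content b + 1) hp hq (by lia) (by lia)
    rw [← (h b hb h3).1, ← (h0 b hb h3).1]

theorem IsTwist.isDirectionSet {i : ℤ} {Q : OutsideDecomposition S} (h : IsDirectionSet P D)
    (ht : IsTwist i P Q) : IsDirectionSet Q (symmDiff D {i}) := by
  intro b hb hb'
  have h1 := h b hb hb'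
  have h2 := ht b hb hb'
  simp only [Finset.mem_symmDiff, Finset.mem_singleton]
  by_cases hi : content b = i
  · rw [(h2.2 hi).1, (h2.2 hi).2]; tauto
  · rw [(h2.1 hi).1, (h2.1 hi).2]; tauto

theorem IsDirectionSet.isTwist {i : ℤ} {Q : OutsideDecomposition S} (h : IsDirectionSet P D)
    (h' : IsDirectionSet Q (symmDiff D {i})) : IsTwist i P Q := by
  intro b hb hb'
  have h1 := h b hb hb'
  have h2 := h' b hb hb'
  simp only [Finset.mem_symmDiff, Finset.mem_singleton] at h2
  tauto

end Directions

/-! ### Existence of a decomposition with prescribed directions -/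

section Existence

variable (S : Finset Cell) (D : Finset ℤ)

/-- Two boxes lie on the same connected component of the intersection of `S` with a strip with
directions `D`. -/
def lineSetoid : Setoid Cell where
  -- The alternative `b = c` makes the relation reflexive on boxes outside `S`.
  r b c := b = c ∨ lineKey D b = lineKey D c ∧
    ∀ e ∈ Set.uIcc (content b) (content c), lineBox D (lineKey D b) e ∈ S
  iseqv :=
    { refl := fun _ => .inl rfl
      symm := by
        rintro b c (h | ⟨h1, h2⟩)
        · exact .inl h.symm
        · exact .inr ⟨h1.symm, by rwa [Set.uIcc_comm, ← h1]⟩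
      trans := by
        rintro a b c (rfl | ⟨h1, h2⟩) (rfl | ⟨h3, h4⟩)
        · exact .inl rfl
        · exact .inr ⟨h3, h4⟩
        · exact .inr ⟨h1, h2⟩
        · refine .inr ⟨h1.trans h3, fun e he => ?_⟩
          rcases Set.uIcc_subset_uIcc_union_uIcc (b := content b) he with he | he
          · exact h2 e he
          · rw [h1]; exact h4 e he }

/-- The partition of `S` into the connected components of its intersections with the strips with
directions `D`. -/
def linePartition : Finpartition S := Finpartition.ofSetSetoid (lineSetoid S D) S

variable {S D}

theorem mem_linePartition_part {b c : Cell} : c ∈ (linePartition S D).part b ↔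
    b ∈ S ∧ c ∈ S ∧ lineKey D b = lineKey D c ∧
      ∀ e ∈ Set.uIcc (content b) (content c), lineBox D (lineKey D b) e ∈ S := by
  rw [linePartition, Finpartition.mem_part_ofSetSetoid_iff_rel]
  refine and_congr_right fun hb => and_congr_right fun hc => ?_
  constructor
  · rintro (rfl | h)
    · exact ⟨rfl, fun e he => by
        rw [Set.uIcc_self, Set.mem_singleton_iff] at he
        rwa [he, lineBox_lineKey]⟩
    · exact h
  · exact .inr

theorem nextBox_mem_linePartition {b : Cell} (hb : b ∈ S) (hn : nextBox D b ∈ S) :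
    nextBox D b ∈ (linePartition S D).part b := by
  refine mem_linePartition_part.2 ⟨hb, hn, by simp [nextBox], fun e he => ?_⟩
  rw [content_nextBox, Set.uIcc_of_le (by lia)] at he
  rcases (show e = content b ∨ e = content b + 1 by have := he.1; have := he.2; lia) with rfl | rfl
  · rwa [lineBox_lineKey]
  · exact hn

/-- A part is an interval of contents on one infinite strip. Convexity comes from `lineBox_between`,
connectedness from successive `nextBox` steps, and a `2 × 2` block is impossible because it contains
two boxes of equal content. -/
theorem linePartition_isStrip {b : Cell} (hb : b ∈ S) : IsStrip ((linePartition S D).part b) := by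
  have hconv : BoxConvex ((linePartition S D).part b) := by
    intro x hx z hz y hxy hyz
    rw [mem_linePartition_part] at *
    obtain ⟨-, hx, hxk, hxl⟩ := hx
    obtain ⟨-, hz, hzk, hzl⟩ := hz
    rw [eq_lineBox hxk.symm rfl] at hxy
    rw [eq_lineBox hzk.symm rfl] at hyz
    obtain ⟨h1, h2⟩ := lineBox_between hxy hyz
    have h3 : ∀ e ∈ Set.uIcc (content x) (content z), lineBox D (lineKey D b) e ∈ S := by
      intro e he
      rcases Set.uIcc_subset_uIcc_union_uIcc (b := content b) he with he | he
      · exact hxl e (by rwa [Set.uIcc_comm])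
      · exact hzl e he
    refine ⟨hb, by rw [h1]; exact h3 _ h2, ?_, fun e he => ?_⟩
    · conv_rhs => rw [h1]
      simp
    · rcases Set.uIcc_subset_uIcc_union_uIcc (b := content x) he with he | he
      · exact hxl e he
      · exact h3 e (Set.uIcc_subset_uIcc_left h2 he)
  refine ⟨hconv.isSkewDiagram, ?_, ?_⟩
  · have hbm := (linePartition S D).mem_part_self.2 hb
    rw [IsEdgeConnected, SimpleGraph.connected_iff_exists_forall_reachable]
    have hreach : ∀ n : ℕ, ∀ x y : ((linePartition S D).part b : Set Cell),
        content x.1 + n = content y.1 →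
        (cellGraph.induce ((linePartition S D).part b : Set Cell)).Reachable x y := by
      intro n
      induction n with
      | zero =>
        rintro ⟨x, hx⟩ ⟨y, hy⟩ h
        have h1 := (mem_linePartition_part.1 hx).2.2.1
        have h2 := (mem_linePartition_part.1 hy).2.2.1
        have : x = y := by
          rw [eq_lineBox h1.symm rfl, eq_lineBox h2.symm rfl]
          exact congrArg _ (by simpa using h)
        subst this
        exact .refl _
      | succ n ih =>
        rintro ⟨x, hx⟩ ⟨y, hy⟩ h
        simp only at h
        push_cast at h
        obtain ⟨-, hxS, hxk, hxl⟩ := mem_linePartition_part.1 hx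
        obtain ⟨-, hyS, hyk, hyl⟩ := mem_linePartition_part.1 hy
        have hn : nextBox D x ∈ (linePartition S D).part b := by
          have hmem : nextBox D x ∈ S := by
            rw [nextBox, ← hxk]
            by_cases hc : content x + 1 ≤ content b
            · exact hxl _ (Set.mem_uIcc.2 (.inr ⟨by lia, hc⟩))
            · exact hyl _ (Set.mem_uIcc.2 (.inl ⟨by lia, by lia⟩))
          have := nextBox_mem_linePartition hxS hmem
          rwa [(linePartition S D).part_eq_of_mem ((linePartition S D).part_mem.2 hb) hx] at this
        refine SimpleGraph.Reachable.trans (SimpleGraph.Adj.reachable ?_)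
          (ih ⟨nextBox D x, hn⟩ ⟨y, hy⟩ (by simp; lia))
        simp only [SimpleGraph.comap_adj, cellGraph, SimpleGraph.fromRel_adj]
        refine ⟨fun h1 => ?_, .inl ?_⟩
        · have := congrArg content h1
          simp at this
        · change _ = _ ∨ _ = _
          change nextBox D x = rightBox x ∨ nextBox D x = aboveBox x
          rw [nextBox_eq]
          split_ifs <;> simp
    refine ⟨⟨b, hbm⟩, fun y => ?_⟩
    rcases le_total (content b) (content y.1) with h | h
    · exact hreach (content y.1 - content b).toNat _ _ (by simp only; lia)
    · exact (hreach (content b - content y.1).toNat y ⟨b, hbm⟩ (by simp only; lia)).symm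
  · rintro i j ⟨h1, -, -, h2⟩
    have h3 := (mem_linePartition_part.1 h1).2.2.1
    have h4 := (mem_linePartition_part.1 h2).2.2.1
    have h5 := (eq_lineBox h3.symm rfl).trans
      ((congrArg (lineBox D (lineKey D b)) (show content (i, j) = content (i + 1, j + 1) by
        simp [content])).trans (eq_lineBox h4.symm rfl).symm)
    simp at h5

variable (S D)

/-- The outside decomposition of `S` with directions `D`. -/
def lineDecomposition : OutsideDecomposition S where
  toFinpartition := linePartition S D
  isStrip T hT := by
    obtain ⟨b, hb⟩ := (linePartition S D).nonempty_of_mem_parts hT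
    rw [← (linePartition S D).part_eq_of_mem hT hb]
    exact linePartition_isStrip ((linePartition S D).subset hT hb)
  start_mem T hT b hb := by
    have hbS := (linePartition S D).subset hT hb.1
    have hp : prevBox D b ∉ S := by
      intro h
      have h1 := nextBox_mem_linePartition (D := D) h (by rwa [nextBox_prevBox])
      rw [nextBox_prevBox] at h1
      have h2 := (linePartition S D).part_eq_of_mem ((linePartition S D).part_mem.2 h) h1
      rw [(linePartition S D).part_eq_of_mem hT hb.1] at h2
      have h3 := hb.2 (prevBox D b) (by rw [h2]; exact (linePartition S D).mem_part_self.2 h)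
      simp at h3
    have h1 := nextBox_eq D (prevBox D b)
    rw [nextBox_prevBox] at h1
    split_ifs at h1
    · right
      intro c hc hcb
      have : c = prevBox D b := by
        rw [IsAbove] at hcb
        rw [hcb, aboveBox, Prod.mk.injEq] at h1
        ext <;> lia
      exact hp (this ▸ hc)
    · left
      intro c hc hcb
      have : c = prevBox D b := by
        rw [IsRightOf] at hcb
        rw [hcb, rightBox, Prod.mk.injEq] at h1
        ext <;> lia
      exact hp (this ▸ hc)
  end_mem T hT b hb := by
    have hbS := (linePartition S D).subset hT hb.1
    have hp : nextBox D b ∉ S := by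
      intro h
      have h1 := nextBox_mem_linePartition hbS h
      rw [(linePartition S D).part_eq_of_mem hT hb.1] at h1
      have h3 := hb.2 _ h1
      simp at h3
    rw [nextBox_eq] at hp
    rw [onRight_iff, onTop_iff]
    split_ifs at hp <;> tauto

/-- The delicate case is an ending box: if its diagonal is to go right, it must not be a corner,
since corners go up by convention. As the next diagonal exists, `IsEdgeConnected.exists_next` puts
the box above or the box to the right into `S`, which excludes corners. -/
theorem lineDecomposition_isDirectionSet (hS : BoxConvex S) (hconn : IsEdgeConnected S) :
    IsDirectionSet (lineDecomposition S D) D := by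
  intro b hb hb'
  obtain ⟨b', hb'S, hb'c⟩ := Finset.mem_image.1 hb'
  have hex := hconn.exists_next hS hb hb'S (by lia)
  have hn : nextBox D b ∈ S → nextBox D b ∈ (lineDecomposition S D).part b :=
    fun h => nextBox_mem_linePartition hb h
  have huniq : ∀ c ∈ (lineDecomposition S D).part b, content c = content b + 1 →
      c = nextBox D b := fun c hc hcc =>
    eq_lineBox (mem_linePartition_part.1 hc).2.2.1.symm hcc
  have hend : nextBox D b ∉ S → IsEndBox ((lineDecomposition S D).part b) b := by
    intro h
    have hbm := (lineDecomposition S D).mem_part_self.2 hb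
    refine ⟨hbm, fun c hc => ?_⟩
    by_contra! hlt
    obtain ⟨-, -, h2, h3⟩ := mem_linePartition_part.1 hc
    exact h (h3 _ (Set.mem_uIcc.2 (.inl ⟨by lia, by lia⟩)))
  have hnend : nextBox D b ∈ S → ¬ IsEndBox ((lineDecomposition S D).part b) b := by
    intro h h1
    have := h1.2 _ (hn h)
    simp at this
  have hab := huniq (aboveBox b)
  have hri := huniq (rightBox b)
  have hne := aboveBox_ne_rightBox b
  have hsub := (lineDecomposition S D).part_subset b
  rw [goesUp_iff _ hb, goesRight_iff _ hb]
  rw [nextBox_eq] at *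
  simp only [content_aboveBox, content_rightBox, forall_const] at hab hri
  split_ifs at * with h1
  · have h2 : rightBox b ∉ (lineDecomposition S D).part b := fun h => hne (hri h).symm
    tauto
  · have h2 : aboveBox b ∉ (lineDecomposition S D).part b := fun h => hne (hab h)
    tauto

end Existence

/-! ### From the Hamel–Goulden matrix to a matrix indexed by boxes -/

section BoxMatrix

variable (K : Type*) [CommRing K] {S : Finset Cell}

/-- A matrix indexed by the boxes of `S` whose determinant is the Hamel–Goulden determinant: every
box but the ending boxes of the strips is linked to the next box by an entry `-1`. -/
def boxMatrix (S : Finset Cell) (D : Finset ℤ) : Matrix S S (MvPowerSeries ℕ K) :=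
  Matrix.of fun b c =>
    if nextBox D b ∈ S then (if c.1 = nextBox D b then -1 else 0)
    else if prevBox D c ∈ S then 0 else segmentSeries K D (content c) (content b)

theorem sum_neg_ite_mul {R : Type*} [CommRing R] (x : Cell) (f : S → R) :
    ∑ j : S, (if j.1 = x then -1 else 0) * f j = if h : x ∈ S then -f ⟨x, h⟩ else 0 := by
  split_ifs with h
  · rw [Finset.sum_eq_single ⟨x, h⟩]
    · simp
    · intro j _ hj
      rw [if_neg fun h1 => hj (Subtype.ext h1), zero_mul]
    · simp
  · refine Finset.sum_eq_zero fun j _ => ?_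
    rw [if_neg (by rintro rfl; exact h j.2), zero_mul]

variable {P : OutsideDecomposition S} {D : Finset ℤ}

theorem IsDirectionSet.content_eq_startContent (h : IsDirectionSet P D) {b : Cell} (hb : b ∈ S)
    (hp : prevBox D b ∉ S) : content b = startContent (P.part b) := by
  rw [h.prevBox_mem_iff hb, not_lt] at hp
  exact le_antisymm hp (startContent_le_content (P.mem_part_self.2 hb))

theorem IsDirectionSet.content_eq_endContent (h : IsDirectionSet P D) {b : Cell} (hb : b ∈ S)
    (hp : nextBox D b ∉ S) : content b = endContent (P.part b) := by
  rw [h.nextBox_mem_iff hb, not_lt] at hp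
  exact le_antisymm (content_le_endContent (P.mem_part_self.2 hb)) hp

/-- The strips of `P` correspond to their starting boxes. -/
def startEquiv (h : IsDirectionSet P D) :
    {b : S // prevBox D b ∉ S} ≃ {T // T ∈ P.parts} :=
  Equiv.ofBijective (fun b => ⟨P.part b.1.1, P.part_mem.2 b.1.2⟩) <| by
    constructor
    · rintro ⟨⟨b, hb⟩, hb'⟩ ⟨⟨c, hc⟩, hc'⟩ hbc
      have hbc : P.part b = P.part c := congrArg Subtype.val hbc
      have h1 := h.content_eq_startContent hb hb'
      rw [hbc, ← h.content_eq_startContent hc hc'] at h1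
      have h2 := P.mem_part_self.2 hb
      rw [hbc] at h2
      have := P.eq_of_mem_part h2 (P.mem_part_self.2 hc) h1
      subst this
      rfl
    · rintro ⟨T, hT⟩
      obtain ⟨b, hb, hb'⟩ := exists_content_eq_startContent (P.nonempty_of_mem_parts hT)
      have hbS := P.subset hT hb
      have hpart := P.part_eq_of_mem hT hb
      refine ⟨⟨⟨b, hbS⟩, ?_⟩, Subtype.ext hpart⟩
      rw [h.prevBox_mem_iff hbS, hpart, hb']
      exact lt_irrefl _

/-- In the intermediate matrices the row of any box may carry the Schur functions of its strip. They
are moved from the row of the starting box to the row of the ending box by passing through `M₃`,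
where all rows of a strip carry them: subtracting the row of the previous box leaves them at the
start, subtracting the row of the next box leaves them at the end. -/
theorem IsDirectionSet.hgMatrix_detEquiv (h : IsDirectionSet P D) (hS : BoxConvex S)
    (hconn : IsEdgeConnected S) :
    DetEquiv (symmetricFunctions K) (hgMatrix K P) (boxMatrix K S D) := by
  set A := symmetricFunctions K
  let H : S → S → MvPowerSeries ℕ K := fun b c =>
    segmentSeries K D (startContent (P.part c)) (endContent (P.part b))
  have hH : ∀ b b' c : S, P.part b = P.part b' → H b c = H b' c := fun b b' c hbb => by
    simp only [H, hbb]
  -- `M₁` is the bordered matrix: starting boxes stand for their strips, the other boxes index the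
  -- unit block.
  let M₁ : Matrix S S (MvPowerSeries ℕ K) := Matrix.of fun b c =>
    if prevBox D b ∈ S then (if b = c then 1 else 0) else if prevBox D c ∈ S then 0 else H b c
  -- In `M₂` the unit rows of the remaining boxes of a strip have been subtracted from the row of
  -- its starting box.
  let M₂ : Matrix S S (MvPowerSeries ℕ K) := Matrix.of fun b c =>
    if prevBox D b ∈ S then (if b = c then 1 else 0)
    else if prevBox D c ∈ S then (if c.1 ∈ P.part b then -1 else 0) else H b c
  let M₃ : Matrix S S (MvPowerSeries ℕ K) := Matrix.of fun b c =>
    if prevBox D c ∈ S then (if c.1 ∈ P.part b ∧ content b < content c then -1 else 0) else H b c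
  have hneg : ∀ (p : Prop) [Decidable p], (if p then (-1 : MvPowerSeries ℕ K) else 0) ∈ A := fun p _ => by
    split_ifs
    · exact neg_mem (one_mem _)
    · exact zero_mem _
  have step₁ : DetEquiv A (hgMatrix K P) M₁ := by
    let E : {T // T ∈ P.parts} ⊕ {b : S // ¬ prevBox D b ∉ S} ≃ S :=
      (Equiv.sumCongr (startEquiv h).symm (Equiv.refl _)).trans (Equiv.sumCompl _)
    refine (DetEquiv.border (κ := {b : S // ¬ prevBox D b ∉ S}) _).trans
      (DetEquiv.symm ((DetEquiv.reindex M₁ E).trans (.of_eq ?_)))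
    ext1 b c
    have hE : ∀ T, prevBox D (E (.inl T)) ∉ S ∧ P.part (E (.inl T)) = T.1 := fun T =>
      ⟨((startEquiv h).symm T).2, congrArg Subtype.val ((startEquiv h).apply_symm_apply T)⟩
    have hE' : ∀ x, prevBox D (E (.inr x)) ∈ S := fun x => not_not.1 x.2
    rcases b with b | b <;> rcases c with c | c
    · simp only [M₁, Matrix.submatrix_apply, Matrix.of_apply, Matrix.fromBlocks_apply₁₁,
        if_neg (hE _).1, H, (hE _).2, hgMatrix]
      obtain ⟨x, hx, hx'⟩ := exists_content_eq_startContent (P.nonempty_of_mem_parts c.2)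
      obtain ⟨y, hy, hy'⟩ := exists_content_eq_endContent (P.nonempty_of_mem_parts b.2)
      rw [h.segmentSchur_eq K hS hconn (hx' ▸ mem_diagonals (P.subset c.2 hx))
        (hy' ▸ mem_diagonals (P.subset b.2 hy))]
    · simp only [M₁, Matrix.submatrix_apply, Matrix.of_apply, Matrix.fromBlocks_apply₁₂,
        if_neg (hE _).1, if_pos (hE' _), Matrix.zero_apply]
    · simp only [M₁, Matrix.submatrix_apply, Matrix.of_apply, Matrix.fromBlocks_apply₂₁,
        if_pos (hE' _), Matrix.zero_apply, EmbeddingLike.apply_eq_iff_eq, reduceCtorEq, if_false]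
    · simp only [M₁, Matrix.submatrix_apply, Matrix.of_apply, Matrix.fromBlocks_apply₂₂,
        if_pos (hE' _), EmbeddingLike.apply_eq_iff_eq, Sum.inr.injEq, Matrix.one_apply]
  have step₂ : DetEquiv A M₁ M₂ := by
    refine (DetEquiv.triangular M₁ (Matrix.of fun b c : S =>
      if prevBox D b ∉ S ∧ prevBox D c ∈ S ∧ c.1 ∈ P.part b then -1 else 0)
      (fun b c => hneg _) (fun b => content b) ?_).trans (.of_eq ?_)
    · intro b c hbc
      obtain ⟨h1, h2, h3⟩ := of_not_not fun h1 => hbc (if_neg h1)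
      have h4 := h.content_eq_startContent b.2 h1
      have h5 := (h.prevBox_mem_iff c.2).1 h2
      rw [P.part_eq_of_mem_part h3] at h5
      lia
    · ext1 b c
      simp only [Matrix.of_apply]
      by_cases hb : prevBox D b ∈ S
      · simp [M₁, M₂, hb]
      · have : ∑ j : S, (if prevBox D b ∉ S ∧ prevBox D j ∈ S ∧ j.1 ∈ P.part b then -1 else 0) *
            M₁ j c = if prevBox D c ∈ S ∧ c.1 ∈ P.part b then -1 else 0 := by
          rw [Finset.sum_eq_single c]
          · by_cases hc : prevBox D c ∈ S <;> simp [hb, hc, M₁]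
          · intro j _ hj
            by_cases hc : prevBox D j ∈ S <;> simp [hc, hj, M₁]
          · simp
        rw [this]
        by_cases hc : prevBox D c ∈ S <;> simp [M₁, M₂, hb, hc]
  -- Subtracting the row of the previous box cancels the Schur functions and all entries `-1`,
  -- except for a `1` left on the diagonal.
  have step₃ : DetEquiv A M₃ M₂ := by
    refine (DetEquiv.triangular M₃ (Matrix.of fun b c : S =>
      if c.1 = prevBox D b then -1 else 0)
      (fun b c => hneg _) (fun b => -content b) ?_).trans (.of_eq ?_)
    · intro b c hbc
      have h1 := of_not_not fun h1 => hbc (if_neg h1)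
      rw [h1, content_prevBox]
      lia
    · ext1 b c
      simp only [Matrix.of_apply, sum_neg_ite_mul]
      by_cases hb : prevBox D b ∈ S
      · have hpart := P.part_eq_of_mem_part (h.prevBox_mem b.2 hb)
        simp only [M₃, M₂, Matrix.of_apply, dif_pos hb, if_pos hb, hpart, content_prevBox]
        by_cases hc : prevBox D c ∈ S
        · simp only [if_pos hc]
          by_cases hcb : b = c
          · subst hcb
            simp [P.mem_part_self.2 b.2]
          · have : c.1 ∈ P.part b → content b ≠ content c := fun h1 h2 =>
              hcb (Subtype.ext (P.eq_of_mem_part (P.mem_part_self.2 b.2) h1 h2))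
            have h2 : (c.1 ∈ P.part b ∧ content b < content c) ↔
                (c.1 ∈ P.part b ∧ content b - 1 < content c) := by
              constructor <;> rintro ⟨h1, h2⟩ <;> have := this h1 <;> exact ⟨h1, by lia⟩
            simp only [h2, if_neg hcb]
            split_ifs <;> simp
        · have hcb : b ≠ c := by rintro rfl; exact hc hb
          simp only [if_neg hc, if_neg hcb, hH ⟨prevBox D b, hb⟩ b c hpart]
          simp
      · simp only [M₃, M₂, Matrix.of_apply, dif_neg hb, if_neg hb, add_zero]
        by_cases hc : prevBox D c ∈ S
        · simp only [if_pos hc]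
          refine if_congr (and_iff_left_of_imp fun h1 => ?_) rfl rfl
          have h5 := (h.prevBox_mem_iff c.2).1 hc
          rwa [P.part_eq_of_mem_part h1, ← h.content_eq_startContent b.2 hb] at h5
        · simp only [if_neg hc]
  -- Subtracting the row of the next box leaves just the link `-1` to that box; rows of ending boxes
  -- are unchanged.
  have step₄ : DetEquiv A M₃ (boxMatrix K S D) := by
    refine (DetEquiv.triangular M₃ (Matrix.of fun b c : S =>
      if c.1 = nextBox D b then -1 else 0)
      (fun b c => hneg _) (fun b => content b) ?_).trans (.of_eq ?_)
    · intro b c hbc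
      have h1 := of_not_not fun h1 => hbc (if_neg h1)
      rw [h1, content_nextBox]
      lia
    · ext1 b c
      simp only [Matrix.of_apply, sum_neg_ite_mul]
      by_cases hb : nextBox D b ∈ S
      · have hmem := h.nextBox_mem b.2 hb
        have hpart := P.part_eq_of_mem_part hmem
        simp only [M₃, boxMatrix, Matrix.of_apply, dif_pos hb, if_pos hb, hpart, content_nextBox]
        by_cases hc : prevBox D c ∈ S
        · simp only [if_pos hc]
          by_cases hcb : c.1 = nextBox D b
          · simp [hcb, hmem]
          · have : c.1 ∈ P.part b → content b + 1 ≠ content c := fun h1 h2 =>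
              hcb (P.eq_of_mem_part h1 hmem (by simp [h2]))
            have h2 : (c.1 ∈ P.part b ∧ content b < content c) ↔
                (c.1 ∈ P.part b ∧ content b + 1 < content c) := by
              constructor <;> rintro ⟨h1, h2⟩ <;> have := this h1 <;> exact ⟨h1, by lia⟩
            simp only [h2, if_neg hcb]
            split_ifs <;> simp
        · have hcb : c.1 ≠ nextBox D b := by
            intro h1
            rw [h1, prevBox_nextBox] at hc
            exact hc b.2
          simp only [if_neg hc, if_neg hcb, hH ⟨nextBox D b, hb⟩ b c hpart]
          simp
      · simp only [M₃, boxMatrix, Matrix.of_apply, dif_neg hb, if_neg hb, add_zero]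
        by_cases hc : prevBox D c ∈ S
        · simp only [if_pos hc]
          refine if_neg fun h1 => ?_
          have := content_le_endContent h1.1
          rw [← h.content_eq_endContent b.2 hb] at this
          lia
        · simp only [if_neg hc, H, ← h.content_eq_endContent b.2 hb,
            ← h.content_eq_startContent c.2 hc]
  exact ((step₁.trans step₂).trans step₃.symm).trans step₄

end BoxMatrix

/-! ### The abstract shift of links between two diagonals -/

section Shift

/-- Passing from the matrix `W` to the matrix `W'`, where the rows `u k` are linked to the columns
`v k` in `W` and to the columns `v (k + 1)` in `W'`. -/
theorem DetEquiv.of_shift {K R : Type*} [CommRing K] [CommRing R] [Algebra K R]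
    {A : Subalgebra K R} {ι : Type*} [Fintype ι] [DecidableEq ι] {W W' : Matrix ι ι R}
    (L : ι → Prop) (a b : ι → R) (ha : ∀ c, a c ∈ A) (hb : ∀ r, b r ∈ A) (u v : ℕ → ι) {n m : ℕ}
    (hm : m = n ∨ m = n + 1) (hu : ∀ k ≤ n, L (u k)) (hv : ∀ k ≤ m, ¬ L (v k))
    (hv' : ∀ j ≤ m, ∀ k ≤ m, v j = v k → j = k)
    (hLL : ∀ r c, L r → L c → (∀ k ≤ n, r ≠ u k) → W r c = W' r c)
    (hLR : ∀ r c, L r → ¬ L c → (∀ k ≤ n, r ≠ u k) ∨ (∀ k ≤ m, c ≠ v k) →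
      W r c = 0 ∧ W' r c = 0)
    (huL : ∀ k ≤ n, ∀ c, L c → W (u k) c = 0 ∧ W' (u k) c = if k = n ∧ m = n then a c else 0)
    (huv : ∀ k ≤ n, ∀ l ≤ m, W (u k) (v l) = (if k = l then -1 else 0) ∧
      W' (u k) (v l) = if l = k + 1 then -1 else if k = n ∧ m = n ∧ l = 0 then 1 else 0)
    (hRL : ∀ r c, ¬ L r → L c → W r c + W' r c = b r * a c)
    (hRR : ∀ r c, ¬ L r → ¬ L c → (∀ k ≤ m, c ≠ v k) → W r c = W' r c)
    (hRv : ∀ r, ¬ L r → ∀ l ≤ m, W r (v l) = (if l = n + 1 then b r else 0) ∧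
      W' r (v l) = if l = 0 then b r else 0) :
    DetEquiv A W W' := by
  obtain ⟨N, hN, hN0, hNs, hNo⟩ := DetEquiv.rotateCols (A := A) W v m hv'
  have hNL : ∀ r c, L c → N r c = W r c := fun r c hc =>
    hNo r c fun k hk h => hv k hk (h ▸ hc)
  -- Column `v 0` of `N` is the old column `v m`. If `m = n + 1` it has entries `b r` in the rows
  -- outside `L`, and this step subtracts the whole rank-one part there; if `m = n` it only creates
  -- the entries `a c` of row `u n`.
  let M₁ : Matrix ι ι R := Matrix.of fun r c => N r c - if L c then W r (v m) * a c else 0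
  have step₁ : DetEquiv A N M₁ := by
    refine (DetEquiv.triangular_cols N (Matrix.of fun j c =>
      if j = v 0 then (if L c then -a c else 0) else 0) ?_ (fun j => if L j then 1 else 0)
      ?_).trans (.of_eq ?_)
    · intro j c
      simp only [Matrix.of_apply]
      split_ifs
      · exact neg_mem (ha c)
      · exact zero_mem _
      · exact zero_mem _
    · intro j c h
      simp only [Matrix.of_apply] at h
      split_ifs at h with h1 h2
      · simp [h1, h2, hv 0 (Nat.zero_le _)]
      · exact absurd rfl h
      · exact absurd rfl h
    · ext r c
      simp only [M₁, Matrix.of_apply, mul_ite, mul_zero, Finset.sum_ite_eq', Finset.mem_univ,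
        if_true, hN0]
      split_ifs <;> ring
  -- For `m = n` the rank-one part is subtracted by means of row `u n`, which now has the entries `a
  -- c` in the columns of `L` and `-1` in column `v 0`; the latter also produces the new entries `b
  -- r` in column `v 0`.
  let M₂ : Matrix ι ι R := Matrix.of fun r c =>
    M₁ r c - if m = n ∧ ¬ L r then b r * M₁ (u n) c else 0
  have step₂ : DetEquiv A M₁ M₂ := by
    refine (DetEquiv.triangular M₁ (Matrix.of fun r j =>
      if j = u n then (if m = n ∧ ¬ L r then -b r else 0) else 0) ?_
      (fun j => if L j then 1 else 0) ?_).trans (.of_eq ?_)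
    · intro r j
      simp only [Matrix.of_apply]
      split_ifs
      · exact neg_mem (hb r)
      · exact zero_mem _
      · exact zero_mem _
    · intro r j h
      simp only [Matrix.of_apply] at h
      split_ifs at h with h1 h2
      · simp [h1, h2, hu n le_rfl]
      · exact absurd rfl h
      · exact absurd rfl h
    · ext r c
      simp only [M₂, Matrix.of_apply, ite_mul, zero_mul, Finset.sum_ite_eq', Finset.mem_univ,
        if_true]
      split_ifs <;> ring
  -- The lower left block is now `W - b a = -W'`, and the shifted links are `1` instead of `-1`.
  -- Changing the signs of the rows and columns outside `L` corrects both and keeps the block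
  -- outside `L`.
  refine ((hN.trans step₁).trans step₂).trans ((DetEquiv.negRowsCols M₂
    (Finset.univ.filter fun j => ¬ L j)).trans (.of_eq ?_))
  ext r c
  simp only [Matrix.of_apply, Finset.mem_filter, Finset.mem_univ, true_and]
  have hM₂ : M₂ r c = N r c - (if L c then W r (v m) * a c else 0) -
      if m = n ∧ ¬ L r then b r * (N (u n) c - if L c then W (u n) (v m) * a c else 0) else 0 :=
    rfl
  rw [hM₂]
  by_cases hr : L r <;> by_cases hc : L c
  · simp only [hr, hc, not_true, and_false, if_false, if_true, hNL r c hc]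
    by_cases hru : ∃ k ≤ n, r = u k
    · obtain ⟨k, hk, rfl⟩ := hru
      have h1 := (huv k hk m le_rfl).1
      rw [(huL k hk c hc).1, (huL k hk c hc).2, h1]
      rcases hm with rfl | rfl
      · by_cases hkm : k = m <;> simp [hkm]
      · simp [show k ≠ n + 1 by lia]
    · push Not at hru
      rw [hLL r c hr hc hru, (hLR r (v m) hr (hv m le_rfl) (.inl hru)).1]
      ring
  · simp only [hr, hc, not_true, not_false_iff, and_false, if_false, if_true]
    by_cases hcv : ∃ l ≤ m, c = v l
    · obtain ⟨l, hl, rfl⟩ := hcv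
      have hNv : N r (v l) = if l = 0 then W r (v m) else -W r (v (l - 1)) := by
        rcases l with _ | l
        · simp [hN0]
        · simp [hNs r l (by lia)]
      rw [hNv]
      by_cases hru : ∃ k ≤ n, r = u k
      · obtain ⟨k, hk, rfl⟩ := hru
        rw [(huv k hk l hl).2, (huv k hk m le_rfl).1, (huv k hk (l - 1) (by lia)).1]
        rcases l with _ | l
        · rcases hm with rfl | rfl
          · by_cases hkm : k = m <;> simp [hkm]
          · simp [show k ≠ n + 1 by lia]
        · by_cases hkl : k = l
          · simp [hkl]
          · simp [hkl, show l ≠ k by lia]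
      · push Not at hru
        rw [(hLR r (v l) hr hc (.inl hru)).2, (hLR r (v m) hr (hv m le_rfl) (.inl hru)).1,
          (hLR r (v (l - 1)) hr (hv _ (by lia)) (.inl hru)).1]
        simp
    · push Not at hcv
      rw [hNo r c hcv, (hLR r c hr hc (.inr hcv)).1, (hLR r c hr hc (.inr hcv)).2]
      simp
  · simp only [hr, hc, not_true, not_false_iff, and_true, if_false, if_true, hNL _ c hc]
    have h1 := hRL r c hr hc
    rw [(hRv r hr m le_rfl).1, (huL n le_rfl c hc).1, (huv n le_rfl m le_rfl).1]
    rcases hm with rfl | rfl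
    · simp only [if_true, Nat.left_eq_add, one_ne_zero, if_false]
      linear_combination -h1
    · simp only [if_true, Nat.add_eq_left, one_ne_zero, if_false]
      linear_combination -h1
  · simp only [hr, hc, not_false_iff, and_true, if_false, if_true, sub_zero]
    by_cases hcv : ∃ l ≤ m, c = v l
    · obtain ⟨l, hl, rfl⟩ := hcv
      have hNv : ∀ r, N r (v l) = if l = 0 then W r (v m) else -W r (v (l - 1)) := by
        intro r
        rcases l with _ | l
        · simp [hN0]
        · simp [hNs r l (by lia)]
      rw [hNv, hNv, (hRv r hr l hl).2, (hRv r hr m le_rfl).1, (hRv r hr (l - 1) (by lia)).1,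
        (huv n le_rfl m le_rfl).1, (huv n le_rfl (l - 1) (by lia)).1]
      rcases l with _ | l
      · rcases hm with rfl | rfl <;> simp
      · rcases hm with rfl | rfl
        · simp [show l ≠ m + 1 by lia, show m ≠ l by lia]
        · simp [show l ≠ n + 1 by lia]
    · push Not at hcv
      rw [hNo r c hcv, hNo _ c hcv, hRR r c hr hc hcv, (hLR (u n) c (hu n le_rfl) hc (.inr hcv)).1]
      simp

end Shift

/-! ### The blocks of the box matrix under a change of one direction -/

section BoxMatrixEntries

variable (K : Type*) [CommRing K] {S : Finset Cell} {D D' : Finset ℤ} {i : ℤ}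

theorem prevBox_eq (D : Finset ℤ) (b : Cell) :
    prevBox D b = if content b - 1 ∈ D then (b.1 + 1, b.2) else (b.1, b.2 - 1) := by
  have h := nextBox_eq D (prevBox D b)
  rw [nextBox_prevBox, content_prevBox] at h
  split_ifs at h ⊢
  · have h1 := congrArg Prod.fst h
    have h2 := congrArg Prod.snd h
    simp only [aboveBox] at h1 h2
    exact Prod.ext (by simp only; lia) h2.symm
  · have h1 := congrArg Prod.fst h
    have h2 := congrArg Prod.snd h
    simp only [rightBox] at h1 h2
    exact Prod.ext h1.symm (by simp only; lia)

theorem nextBox_congr (h : ∀ c, c ≠ i → (c ∈ D ↔ c ∈ D')) {b : Cell} (hb : content b ≠ i) :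
    nextBox D b = nextBox D' b := by
  simp only [nextBox_eq, h _ hb]

theorem prevBox_congr (h : ∀ c, c ≠ i → (c ∈ D ↔ c ∈ D')) {b : Cell} (hb : content b ≠ i + 1) :
    prevBox D b = prevBox D' b := by
  simp only [prevBox_eq, h _ (show content b - 1 ≠ i by lia)]

theorem boxMatrix_apply_eq_zero {b c : S} (h : content b + 1 < content c) :
    boxMatrix K S D b c = 0 := by
  simp only [boxMatrix, Matrix.of_apply, segmentSeries]
  split_ifs with h1 h2 h3 h4 h5
  · rw [h2, content_nextBox] at h
    lia
  · rfl
  · rfl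
  · lia
  · lia
  · rfl

theorem boxMatrix_apply_of_next {b c : S} (h : nextBox D b ∈ S) :
    boxMatrix K S D b c = if c.1 = nextBox D b then -1 else 0 := by
  simp [boxMatrix, h]

theorem boxMatrix_apply_of_ne {b c : S} (h : content c ≠ content b + 1) :
    boxMatrix K S D b c = if nextBox D b ∈ S then 0 else if prevBox D c ∈ S then 0 else
      segmentSeries K D (content c) (content b) := by
  simp only [boxMatrix, Matrix.of_apply]
  rw [if_neg (show c.1 ≠ nextBox D b from fun h1 => h (by rw [h1, content_nextBox]))]

theorem boxMatrix_congr (h : ∀ c, c ≠ i → (c ∈ D ↔ c ∈ D')) {b c : S} (hb : content b ≠ i)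
    (hc : content c ≠ i + 1) (hbc : content b < i ∨ i < content c) :
    boxMatrix K S D b c = boxMatrix K S D' b c := by
  simp only [boxMatrix, Matrix.of_apply, nextBox_congr h hb, prevBox_congr h hc]
  rw [segmentSeries_congr K fun e h1 h2 => h e (by lia)]

variable (S D i) in
/-- The column factor of the box `c` in the splitting of segments after `i`. -/
def leftFactor (c : Cell) : MvPowerSeries ℕ K :=
  if prevBox D c ∈ S then 0 else segmentSeries K D (content c) i

variable (S D i) in
/-- The row factor of the box `b` in the splitting of segments after `i`. -/
def rightFactor (b : Cell) : MvPowerSeries ℕ K :=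
  if nextBox D b ∈ S then 0 else segmentSeries K D (i + 1) (content b)

theorem leftFactor_mem (c : Cell) : leftFactor K S D i c ∈ symmetricFunctions K := by
  unfold leftFactor
  split_ifs
  · exact zero_mem _
  · exact segmentSeries_mem K D _ _

theorem rightFactor_mem (b : Cell) : rightFactor K S D i b ∈ symmetricFunctions K := by
  unfold rightFactor
  split_ifs
  · exact zero_mem _
  · exact segmentSeries_mem K D _ _

theorem leftFactor_congr (h : ∀ c, c ≠ i → (c ∈ D ↔ c ∈ D')) {c : Cell} (hc : content c ≤ i) :
    leftFactor K S D i c = leftFactor K S D' i c := by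
  unfold leftFactor
  rw [prevBox_congr h (by lia), segmentSeries_congr K fun e h1 h2 => h e (by lia)]

theorem rightFactor_congr (h : ∀ c, c ≠ i → (c ∈ D ↔ c ∈ D')) {b : Cell} (hb : i < content b) :
    rightFactor K S D i b = rightFactor K S D' i b := by
  unfold rightFactor
  rw [nextBox_congr h (by lia), segmentSeries_congr K fun e h1 h2 => h e (by lia)]

/-- The change at `i` does not affect which of these rows belong to ending boxes and which of these
columns to starting boxes, so the gluing identity applies entry by entry. -/
theorem boxMatrix_add (h : ∀ c, c ≠ i → (c ∈ D ↔ c ∈ D')) (hi : i ∈ D ↔ i ∉ D') {b c : S}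
    (hb : i < content b) (hc : content c ≤ i) :
    boxMatrix K S D b c + boxMatrix K S D' b c =
      rightFactor K S D i b * leftFactor K S D i c := by
  rw [boxMatrix_apply_of_ne K (by lia), boxMatrix_apply_of_ne K (by lia),
    ← nextBox_congr h (by lia), ← prevBox_congr h (by lia), leftFactor, rightFactor]
  split_ifs
  · simp
  · simp
  · simp
  · rw [mul_comm, segmentSeries_mul K hc hb hi h]

theorem boxMatrix_apply_of_content_eq {b c : S} (hb : content b = i) (hc : content c ≤ i) :
    boxMatrix K S D b c = if nextBox D b ∈ S then 0 else leftFactor K S D i c := by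
  rw [boxMatrix_apply_of_ne K (by lia), hb]
  rfl

theorem boxMatrix_apply_of_content_eq_succ {b c : S} (hb : i < content b)
    (hc : content c = i + 1) :
    boxMatrix K S D b c = if prevBox D c ∈ S then 0 else rightFactor K S D i b := by
  rw [boxMatrix_apply_of_ne K (by lia), hc, rightFactor]
  split_ifs <;> rfl

/-- The entry `1` is the convention for the empty segment `[q + 1, q]`. It supplies the exceptional
`1` in `DetEquiv.of_shift`, between the box that becomes an ending box and the one that becomes a
starting box. -/
theorem boxMatrix_apply_of_end {b c : S} (hbc : content c = content b + 1)
    (h : nextBox D b ∉ S) :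
    boxMatrix K S D b c = if prevBox D c ∈ S then 0 else 1 := by
  simp [boxMatrix, h, hbc, segmentSeries]

/-- Changing the direction of the diagonal of content `i` when the boxes `u k` are linked to the
boxes `v k` before and to the boxes `v (k + 1)` afterwards. -/
theorem boxMatrix_detEquiv_of_le (h : ∀ c, c ≠ i → (c ∈ D ↔ c ∈ D')) (hi : i ∈ D ↔ i ∉ D')
    {n m : ℕ} (hm : m = n ∨ m = n + 1) (u v : ℕ → S)
    (hu : ∀ k ≤ n, content (u k) = i) (hu' : ∀ b : S, content b = i → ∃ k ≤ n, b = u k)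
    (hv : ∀ k ≤ m, content (v k) = i + 1)
    (hv' : ∀ b : S, content b = i + 1 → ∃ k ≤ m, b = v k)
    (hinj : ∀ j ≤ m, ∀ k ≤ m, v j = v k → j = k)
    (hD : ∀ k ≤ n, nextBox D (u k) = v k)
    (hD' : ∀ k ≤ n, k < m → nextBox D' (u k) = v (k + 1))
    (hend : m = n → nextBox D' (u n) ∉ S) (hstart : prevBox D' (v 0) ∉ S)
    (hstart' : m = n + 1 → prevBox D (v m) ∉ S) :
    DetEquiv (symmetricFunctions K) (boxMatrix K S D) (boxMatrix K S D') := by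
  have hnext : ∀ k ≤ n, nextBox D (u k) ∈ S := fun k hk => hD k hk ▸ (v k).2
  have hnext' : ∀ k ≤ n, k < m → nextBox D' (u k) ∈ S := fun k hk hkm =>
    hD' k hk hkm ▸ (v (k + 1)).2
  have hcontent : ∀ r c : S, content r ≤ i → ¬ content c ≤ i →
      (∀ k ≤ n, r ≠ u k) ∨ (∀ k ≤ m, c ≠ v k) → content r + 1 < content c := by
    intro r c hr hc hor
    by_contra hlt
    rcases hor with hor | hor
    · obtain ⟨k, hk, hk'⟩ := hu' r (by lia)
      exact hor k hk hk'
    · obtain ⟨k, hk, hk'⟩ := hv' c (by lia)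
      exact hor k hk hk'
  refine DetEquiv.of_shift (fun b : S => content b ≤ i) (fun c => leftFactor K S D i c)
    (fun b => rightFactor K S D i b) (fun c => leftFactor_mem K c) (fun b => rightFactor_mem K b)
    u v hm (fun k hk => (hu k hk).le) (fun k hk => by rw [hv k hk]; lia) hinj ?_ ?_ ?_ ?_ ?_ ?_ ?_
  · intro r c hr hc hru
    have hri : content r ≠ i := fun hri => by
      obtain ⟨k, hk, hk'⟩ := hu' r hri
      exact hru k hk hk'
    exact boxMatrix_congr K h hri (by lia) (.inl (by lia))
  · intro r c hr hc hor
    have := hcontent r c hr hc hor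
    exact ⟨boxMatrix_apply_eq_zero K this, boxMatrix_apply_eq_zero K this⟩
  · intro k hk c hc
    rw [boxMatrix_apply_of_content_eq K (hu k hk) hc, if_pos (hnext k hk),
      boxMatrix_apply_of_content_eq K (hu k hk) hc, leftFactor_congr K h hc]
    refine ⟨rfl, ?_⟩
    by_cases hkm : k < m
    · rw [if_pos (hnext' k hk hkm), if_neg (by lia)]
    · obtain ⟨rfl, rfl⟩ : k = n ∧ m = k := by lia
      rw [if_neg (hend rfl), if_pos ⟨rfl, rfl⟩]
  · intro k hk l hl
    constructor
    · rw [boxMatrix_apply_of_next K (hnext k hk), hD k hk]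
      exact if_congr ⟨fun h1 => (hinj _ hl _ (by lia) (Subtype.ext h1)).symm, by rintro rfl; rfl⟩
        rfl rfl
    · by_cases hkm : k < m
      · rw [boxMatrix_apply_of_next K (hnext' k hk hkm), hD' k hk hkm, 
          if_neg (c := k = n ∧ m = n ∧ l = 0) (by lia)]
        exact if_congr ⟨fun h1 => hinj _ hl _ (by lia) (Subtype.ext h1), by rintro rfl; rfl⟩
          rfl rfl
      · obtain ⟨rfl, rfl⟩ : k = n ∧ m = k := by lia
        rw [boxMatrix_apply_of_end K (by rw [hv l hl, hu _ hk]) (hend rfl)]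
        rcases l with _ | l
        · simp [hstart]
        · have h1 : prevBox D' (v (l + 1)) ∈ S := by
            rw [← hD' l (by lia) (by lia), prevBox_nextBox]
            exact (u l).2
          simp [h1, show l ≠ m by lia]
  · intro r c hr hc
    exact boxMatrix_add K h hi (by lia) hc
  · intro r c hr hc hcv
    have hci : content c ≠ i + 1 := fun hci => by
      obtain ⟨k, hk, hk'⟩ := hv' c hci
      exact hcv k hk hk'
    exact boxMatrix_congr K h (by lia) hci (.inr (by lia))
  · intro r hr l hl
    rw [boxMatrix_apply_of_content_eq_succ K (by lia) (hv l hl),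
      boxMatrix_apply_of_content_eq_succ K (by lia) (hv l hl), ← rightFactor_congr K h (by lia)]
    constructor
    · by_cases hln : l ≤ n
      · have h1 : prevBox D (v l) ∈ S := by
          rw [← hD l hln, prevBox_nextBox]
          exact (u l).2
        rw [if_pos h1, if_neg (by lia)]
      · obtain rfl : l = m := by lia
        rw [if_neg (hstart' (by lia)), if_pos (by lia)]
    · rcases l with _ | l
      · simp [hstart]
      · have h1 : prevBox D' (v (l + 1)) ∈ S := by
          rw [← hD' l (by lia) (by lia), prevBox_nextBox]
          exact (u l).2
        simp [h1]

/-- Changing the direction of the diagonal of content `i` when the boxes `u k` are linked to the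
boxes `v k` before and the boxes `u (k + 1)` to the boxes `v k` afterwards. -/
theorem boxMatrix_detEquiv_of_gt (h : ∀ c, c ≠ i → (c ∈ D ↔ c ∈ D')) (hi : i ∈ D ↔ i ∉ D')
    {n : ℕ} (u v : ℕ → S)
    (hu : ∀ k ≤ n + 1, content (u k) = i) (hu' : ∀ b : S, content b = i → ∃ k ≤ n + 1, b = u k)
    (hv : ∀ k ≤ n, content (v k) = i + 1)
    (hv' : ∀ b : S, content b = i + 1 → ∃ k ≤ n, b = v k)
    (hinj : ∀ j ≤ n + 1, ∀ k ≤ n + 1, u j = u k → j = k)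
    (hD : ∀ k ≤ n, nextBox D (u k) = v k)
    (hD' : ∀ k ≤ n, nextBox D' (u (k + 1)) = v k)
    (hend : nextBox D (u (n + 1)) ∉ S) (hend' : nextBox D' (u 0) ∉ S) :
    DetEquiv (symmetricFunctions K) (boxMatrix K S D) (boxMatrix K S D') := by
  have hprev : ∀ k ≤ n, prevBox D (v k) = u k := fun k hk => by rw [← hD k hk, prevBox_nextBox]
  have hprev' : ∀ k ≤ n, prevBox D' (v k) = u (k + 1) := fun k hk => by
    rw [← hD' k hk, prevBox_nextBox]
  have hnext : ∀ k ≤ n + 1, nextBox D (u k) ∈ S ↔ k ≤ n := fun k hk => by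
    constructor
    · intro h1
      by_contra h2
      exact hend (by rwa [show n + 1 = k by lia])
    · exact fun h1 => hD k h1 ▸ (v k).2
  have hnext' : ∀ k ≤ n + 1, nextBox D' (u k) ∈ S ↔ k ≠ 0 := fun k hk => by
    constructor
    · rintro h1 rfl
      exact hend' h1
    · intro h1
      obtain ⟨l, rfl⟩ := Nat.exists_eq_succ_of_ne_zero h1
      exact hD' l (by lia) ▸ (v l).2
  have hcontent : ∀ r c : S, content r ≤ i → ¬ content c ≤ i →
      (∀ k ≤ n, c ≠ v k) ∨ (∀ k ≤ n + 1, r ≠ u k) → content r + 1 < content c := by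
    intro r c hr hc hor
    by_contra hlt
    rcases hor with hor | hor
    · obtain ⟨k, hk, hk'⟩ := hv' c (by lia)
      exact hor k hk hk'
    · obtain ⟨k, hk, hk'⟩ := hu' r (by lia)
      exact hor k hk hk'
  -- Transposition exchanges the two diagonals, so that the longer one provides the rotated columns,
  -- as in the case `m = n + 1` of `DetEquiv.of_shift`.
  have key : DetEquiv (symmetricFunctions K) (boxMatrix K S D).transpose
      (boxMatrix K S D').transpose := by
    refine DetEquiv.of_shift (fun b : S => ¬ content b ≤ i) (fun b => rightFactor K S D i b)
      (fun c => leftFactor K S D i c) (fun b => rightFactor_mem K b) (fun c => leftFactor_mem K c)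
      v u (.inr rfl) (fun k hk => by rw [hv k hk]; lia) (fun k hk => by rw [hu k hk]; simp) hinj
      ?_ ?_ ?_ ?_ ?_ ?_ ?_
    · intro c r hc hr hcv
      have hci : content c ≠ i + 1 := fun hci => by
        obtain ⟨k, hk, hk'⟩ := hv' c hci
        exact hcv k hk hk'
      exact boxMatrix_congr K h (by lia) hci (.inr (by lia))
    · intro c r hc hr hor
      have := hcontent r c (not_not.1 hr) hc hor
      exact ⟨boxMatrix_apply_eq_zero K this, boxMatrix_apply_eq_zero K this⟩
    · intro k hk r hr
      simp only [Matrix.transpose_apply]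
      rw [boxMatrix_apply_of_content_eq_succ K (by lia) (hv k hk), hprev k hk,
        boxMatrix_apply_of_content_eq_succ K (by lia) (hv k hk), hprev' k hk]
      simp
    · intro k hk l hl
      simp only [Matrix.transpose_apply]
      constructor
      · by_cases hln : l ≤ n
        · rw [boxMatrix_apply_of_next K ((hnext l hl).2 hln), hD l hln]
          refine if_congr ⟨fun h1 => ?_, by rintro rfl; rfl⟩ rfl rfl
          exact hinj k (by lia) l hl (Subtype.ext (by rw [← hprev k hk, h1, hprev l hln]))
        · rw [boxMatrix_apply_of_end K (by rw [hv k hk, hu l hl])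
            (by rw [hnext l hl]; exact hln), hprev k hk, if_pos (u k).2, if_neg (by lia)]
      · rw [if_neg (c := k = n ∧ n + 1 = n ∧ l = 0) (by lia)]
        rcases l with _ | l
        · rw [boxMatrix_apply_of_end K (by rw [hv k hk, hu 0 hl]) hend', hprev' k hk,
            if_pos (u (k + 1)).2, if_neg (by lia)]
        · rw [boxMatrix_apply_of_next K ((hnext' (l + 1) hl).2 (by lia)), hD' l (by lia)]
          refine if_congr ⟨fun h1 => ?_, ?_⟩ rfl rfl
          · exact (hinj (k + 1) (by lia) (l + 1) hl (Subtype.ext (by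
              rw [← hprev' k hk, h1, hprev' l (by lia)]))).symm
          · intro h1
            rw [show k = l by lia]
    · intro c r hc hr
      simp only [Matrix.transpose_apply]
      rw [boxMatrix_add K h hi (by lia) (by lia), mul_comm]
    · intro c r hc hr hru
      have hri : content r ≠ i := fun hri => by
        obtain ⟨k, hk, hk'⟩ := hu' r hri
        exact hru k hk hk'
      exact boxMatrix_congr K h hri (by lia) (.inl (by lia))
    · intro r hr l hl
      simp only [Matrix.transpose_apply]
      rw [boxMatrix_apply_of_content_eq K (hu l hl) (by lia),
        boxMatrix_apply_of_content_eq K (hu l hl) (by lia),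
        ← leftFactor_congr K h (show content r ≤ i by lia)]
      simp only [hnext l hl, hnext' l hl]
      constructor
      · by_cases hln : l ≤ n
        · rw [if_pos hln, if_neg (by lia)]
        · rw [if_neg hln, if_pos (by lia)]
      · by_cases hl0 : l = 0 <;> simp [hl0]
  simpa using key.transpose

end BoxMatrixEntries

/-! ### Relative position of two consecutive diagonals -/

section DiagonalShape

/-- The box of content `c` in row `r`. -/
def diagBox (c r : ℤ) : Cell := (r, r + c)

@[simp] theorem content_diagBox (c r : ℤ) : content (diagBox c r) = c := by
  simp [content, diagBox]

theorem eq_diagBox {b : Cell} {c : ℤ} (h : content b = c) : b = diagBox c b.1 := by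
  rw [content_eq_iff] at h
  exact Prod.ext rfl h

theorem diagBox_injective (c : ℤ) : Function.Injective (diagBox c) := fun _ _ h =>
  congrArg Prod.fst h

theorem aboveBox_diagBox (c r : ℤ) : aboveBox (diagBox c r) = diagBox (c + 1) (r - 1) := by
  ext <;> simp [aboveBox, diagBox]

theorem rightBox_diagBox (c r : ℤ) : rightBox (diagBox c r) = diagBox (c + 1) r := by
  ext <;> simp [rightBox, diagBox, add_assoc]

variable {S : Finset Cell} {D D' : Finset ℤ} {i : ℤ}

theorem nextBox_diagBox_of_mem (h : i ∈ D) (r : ℤ) :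
    nextBox D (diagBox i r) = diagBox (i + 1) (r - 1) := by
  rw [nextBox_eq, content_diagBox, if_pos h, aboveBox_diagBox]

theorem nextBox_diagBox_of_notMem (h : i ∉ D) (r : ℤ) :
    nextBox D (diagBox i r) = diagBox (i + 1) r := by
  rw [nextBox_eq, content_diagBox, if_neg h, rightBox_diagBox]

theorem prevBox_diagBox_of_mem (h : i ∈ D) (r : ℤ) :
    prevBox D (diagBox (i + 1) r) = diagBox i (r + 1) := by
  have := nextBox_diagBox_of_mem h (r + 1)
  rw [add_sub_cancel_right] at this
  rw [← this, prevBox_nextBox]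

theorem prevBox_diagBox_of_notMem (h : i ∉ D) (r : ℤ) :
    prevBox D (diagBox (i + 1) r) = diagBox i r := by
  rw [← nextBox_diagBox_of_notMem h, prevBox_nextBox]

theorem BoxConvex.exists_rows (hS : BoxConvex S) {c : ℤ} (hc : c ∈ diagonals S) :
    ∃ a b : ℤ, a ≤ b ∧ ∀ r, diagBox c r ∈ S ↔ a ≤ r ∧ r ≤ b := by
  let R : Finset ℤ := (S.filter fun b => content b = c).image Prod.fst
  have hR : ∀ r, r ∈ R ↔ diagBox c r ∈ S := by
    intro r
    simp only [R, Finset.mem_image, Finset.mem_filter]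
    constructor
    · rintro ⟨b, ⟨hb, hbc⟩, rfl⟩
      rwa [← eq_diagBox hbc]
    · exact fun h => ⟨_, ⟨h, content_diagBox c r⟩, rfl⟩
  have hne : R.Nonempty := by
    obtain ⟨b, hb, hbc⟩ := Finset.mem_image.1 hc
    exact ⟨b.1, (hR _).2 (by rwa [← eq_diagBox hbc])⟩
  refine ⟨R.min' hne, R.max' hne, R.min'_le_max' hne, fun r => ?_⟩
  rw [← hR]
  constructor
  · exact fun h => ⟨R.min'_le r h, R.le_max' r h⟩
  · rintro ⟨h1, h2⟩
    rw [hR]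
    refine hS _ ((hR _).1 (R.min'_mem hne)) _ ((hR _).1 (R.max'_mem hne)) _ ⟨h1, ?_⟩ ⟨h2, ?_⟩
    · simp only [diagBox]; lia
    · simp only [diagBox]; lia

theorem exists_enumeration {a b c : ℤ} {n : ℕ} (hrows : ∀ r, diagBox c r ∈ S ↔ a ≤ r ∧ r ≤ b)
    (g : ℕ → ℤ) (g' : ℤ → ℕ) (hg : ∀ k ≤ n, (a ≤ g k ∧ g k ≤ b) ∧ g' (g k) = k)
    (hg' : ∀ r, a ≤ r → r ≤ b → g' r ≤ n ∧ g (g' r) = r) :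
    ∃ u : ℕ → S, (∀ k ≤ n, (u k).1 = diagBox c (g k)) ∧ (∀ k ≤ n, content (u k) = c) ∧
      (∀ x : S, content x = c → ∃ k ≤ n, x = u k) ∧
      ∀ j ≤ n, ∀ k ≤ n, u j = u k → j = k := by
  have hmem : ∀ k ≤ n, diagBox c (g k) ∈ S := fun k hk => (hrows _).2 (hg k hk).1
  let u : ℕ → S := fun k =>
    if h : k ≤ n then ⟨_, hmem k h⟩ else ⟨_, hmem 0 (Nat.zero_le _)⟩
  have hu : ∀ k ≤ n, (u k).1 = diagBox c (g k) := fun k hk => by simp only [u, dif_pos hk]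
  refine ⟨u, hu, fun k hk => by rw [hu k hk, content_diagBox], fun x hx => ?_,
    fun j hj k hk hjk => ?_⟩
  · have hx' := eq_diagBox hx
    obtain ⟨h1, h2⟩ := (hrows x.1.1).1 (hx' ▸ x.2)
    obtain ⟨h3, h4⟩ := hg' _ h1 h2
    exact ⟨_, h3, Subtype.ext (by rw [hu _ h3, h4]; exact hx')⟩
  · have h1 := congrArg Subtype.val hjk
    rw [hu j hj, hu k hk, (diagBox_injective c).eq_iff] at h1
    rw [← (hg j hj).2, h1, (hg k hk).2]

theorem exists_enumeration_up {a b c : ℤ} {n : ℕ}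
    (hrows : ∀ r, diagBox c r ∈ S ↔ a ≤ r ∧ r ≤ b) (hn : b = a + n) :
    ∃ u : ℕ → S, (∀ k ≤ n, (u k).1 = diagBox c (a + k)) ∧ (∀ k ≤ n, content (u k) = c) ∧
      (∀ x : S, content x = c → ∃ k ≤ n, x = u k) ∧
      ∀ j ≤ n, ∀ k ≤ n, u j = u k → j = k :=
  exists_enumeration hrows (fun k => a + k) (fun r => (r - a).toNat)
    (fun k hk => by lia) (fun r h1 h2 => by lia)

theorem exists_enumeration_down {a b c : ℤ} {n : ℕ}
    (hrows : ∀ r, diagBox c r ∈ S ↔ a ≤ r ∧ r ≤ b) (hn : b = a + n) :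
    ∃ u : ℕ → S, (∀ k ≤ n, (u k).1 = diagBox c (b - k)) ∧ (∀ k ≤ n, content (u k) = c) ∧
      (∀ x : S, content x = c → ∃ k ≤ n, x = u k) ∧
      ∀ j ≤ n, ∀ k ≤ n, u j = u k → j = k :=
  exists_enumeration hrows (fun k => b - k) (fun r => (b - r).toNat)
    (fun k hk => by lia) (fun r h1 h2 => by lia)

variable (K : Type*) [CommRing K]

/-- Here every box of diagonal `i` has a box above it, so going up matches the diagonals from their
top ends, and going right shifts this matching down by one row. The last box loses its partner
exactly when `b' = b - 1`. -/
theorem boxMatrix_detEquiv_of_start_eq_sub {a b a' b' : ℤ}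
    (hU : ∀ r, diagBox i r ∈ S ↔ a ≤ r ∧ r ≤ b)
    (hV : ∀ r, diagBox (i + 1) r ∈ S ↔ a' ≤ r ∧ r ≤ b') (hab : a ≤ b) (ha : a' = a - 1)
    (hb : b' = b - 1 ∨ b' = b) (h : ∀ c, c ≠ i → (c ∈ D ↔ c ∈ D')) (hD : i ∈ D) (hD' : i ∉ D') :
    DetEquiv (symmetricFunctions K) (boxMatrix K S D) (boxMatrix K S D') := by
  obtain ⟨n, hn⟩ := Int.le.dest hab
  obtain ⟨m, hm⟩ := Int.le.dest (show a' ≤ b' by lia)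
  obtain ⟨u, hu, hu1, hu2, -⟩ := exists_enumeration_up hU hn.symm
  obtain ⟨v, hv, hv1, hv2, hv3⟩ := exists_enumeration_up hV hm.symm
  refine boxMatrix_detEquiv_of_le K h (by tauto) (by lia) u v hu1 hu2 hv1 hv2 hv3 ?_ ?_ ?_ ?_ ?_
  · intro k hk
    rw [hu k hk, nextBox_diagBox_of_mem hD, hv k (by lia)]
    congr 1
    lia
  · intro k hk hkm
    rw [hu k hk, nextBox_diagBox_of_notMem hD', hv (k + 1) (by lia)]
    congr 1
    push_cast
    lia
  · intro hmn
    rw [hu n le_rfl, nextBox_diagBox_of_notMem hD', hV]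
    lia
  · rw [hv 0 (Nat.zero_le _), prevBox_diagBox_of_notMem hD', hU]
    lia
  · intro hmn
    rw [hv m le_rfl, prevBox_diagBox_of_mem hD, hU]
    lia

theorem boxMatrix_detEquiv_of_end_eq_sub {a b b' : ℤ}
    (hU : ∀ r, diagBox i r ∈ S ↔ a ≤ r ∧ r ≤ b)
    (hV : ∀ r, diagBox (i + 1) r ∈ S ↔ a ≤ r ∧ r ≤ b') (hab' : a ≤ b')
    (hb : b' = b - 1) (h : ∀ c, c ≠ i → (c ∈ D ↔ c ∈ D')) (hD : i ∉ D) (hD' : i ∈ D') :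
    DetEquiv (symmetricFunctions K) (boxMatrix K S D) (boxMatrix K S D') := by
  obtain ⟨n, hn⟩ := Int.le.dest hab'
  obtain ⟨u, hu, hu1, hu2, hu3⟩ := exists_enumeration_up (n := n + 1) hU (by lia)
  obtain ⟨v, hv, hv1, hv2, -⟩ := exists_enumeration_up hV hn.symm
  refine boxMatrix_detEquiv_of_gt K h (by tauto) u v hu1 hu2 hv1 hv2 hu3 ?_ ?_ ?_ ?_
  · intro k hk
    rw [hu k (by lia), nextBox_diagBox_of_notMem hD, hv k hk]
  · intro k hk
    rw [hu (k + 1) (by lia), nextBox_diagBox_of_mem hD', hv k hk]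
    congr 1
    push_cast
    lia
  · rw [hu _ le_rfl, nextBox_diagBox_of_notMem hD, hV]
    lia
  · rw [hu 0 (Nat.zero_le _), nextBox_diagBox_of_mem hD', hV]
    lia

/-- Going right matches all boxes, and going up shifts the matching towards smaller rows; hence the
enumeration from the bottom. -/
theorem boxMatrix_detEquiv_of_rows_eq {a b : ℤ}
    (hU : ∀ r, diagBox i r ∈ S ↔ a ≤ r ∧ r ≤ b)
    (hV : ∀ r, diagBox (i + 1) r ∈ S ↔ a ≤ r ∧ r ≤ b) (hab : a ≤ b)
    (h : ∀ c, c ≠ i → (c ∈ D ↔ c ∈ D')) (hD : i ∉ D) (hD' : i ∈ D') :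
    DetEquiv (symmetricFunctions K) (boxMatrix K S D) (boxMatrix K S D') := by
  obtain ⟨n, hn⟩ := Int.le.dest hab
  obtain ⟨u, hu, hu1, hu2, -⟩ := exists_enumeration_down hU hn.symm
  obtain ⟨v, hv, hv1, hv2, hv3⟩ := exists_enumeration_down hV hn.symm
  refine boxMatrix_detEquiv_of_le K h (by tauto) (.inl rfl) u v hu1 hu2 hv1 hv2 hv3 ?_ ?_ ?_ ?_ ?_
  · intro k hk
    rw [hu k hk, nextBox_diagBox_of_notMem hD, hv k hk]
  · intro k hk hkm
    rw [hu k hk, nextBox_diagBox_of_mem hD', hv (k + 1) (by lia)]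
    congr 1
    push_cast
    lia
  · intro _
    rw [hu n le_rfl, nextBox_diagBox_of_mem hD', hV]
    lia
  · rw [hv 0 (Nat.zero_le _), prevBox_diagBox_of_mem hD', hU]
    lia
  · intro hnn
    lia

/-- Every box of diagonal `i` has a successor in `S` and every box of diagonal `i + 1` a
predecessor. Applied to the extreme boxes, this bounds the row intervals: `a'` is `a - 1` or `a`,
and `b'` is `b - 1` or `b`. -/
theorem boxMatrix_detEquiv (hS : BoxConvex S) (hconn : IsEdgeConnected S)
    (hi : i ∈ diagonals S) (hi' : i + 1 ∈ diagonals S) (h : ∀ c, c ≠ i → (c ∈ D ↔ c ∈ D'))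
    (hD : i ∈ D) (hD' : i ∉ D') :
    DetEquiv (symmetricFunctions K) (boxMatrix K S D) (boxMatrix K S D') := by
  obtain ⟨a, b, hab, hU⟩ := hS.exists_rows hi
  obtain ⟨a', b', hab', hV⟩ := hS.exists_rows hi'
  have hnext : ∀ r, a ≤ r → r ≤ b → (a' ≤ r - 1 ∧ r - 1 ≤ b') ∨ (a' ≤ r ∧ r ≤ b') := by
    intro r h1 h2
    have := hconn.exists_next hS ((hU r).2 ⟨h1, h2⟩) ((hV a').2 ⟨le_rfl, hab'⟩) (by simp)
    rwa [aboveBox_diagBox, rightBox_diagBox, hV, hV] at this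
  have hprev : ∀ r, a' ≤ r → r ≤ b' → (a ≤ r ∧ r ≤ b) ∨ (a ≤ r + 1 ∧ r + 1 ≤ b) := by
    intro r h1 h2
    obtain ⟨x, hx, hx'⟩ :=
      hconn.exists_prev hS ((hV r).2 ⟨h1, h2⟩) ((hU a).2 ⟨le_rfl, hab⟩) (by simp)
    have hxc : content x = i := by
      rcases hx' with hx' | hx' <;> have := congrArg content hx' <;> simp at this <;> exact this.symm
    rw [eq_diagBox hxc] at hx hx'
    rw [aboveBox_diagBox, rightBox_diagBox, (diagBox_injective _).eq_iff,
      (diagBox_injective _).eq_iff] at hx'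
    rw [hU] at hx
    lia
  have h1 := hnext a le_rfl hab
  have h2 := hnext b hab le_rfl
  have h3 := hprev a' le_rfl hab'
  have h4 := hprev b' hab' le_rfl
  have h' : ∀ c, c ≠ i → (c ∈ D' ↔ c ∈ D) := fun c hc => (h c hc).symm
  have hb : b' = b - 1 ∨ b' = b := by lia
  rcases (show a' = a - 1 ∨ a' = a by lia) with ha | rfl
  · exact boxMatrix_detEquiv_of_start_eq_sub K hU hV hab ha hb h hD hD'
  · rcases hb with hb | rfl
    · exact (boxMatrix_detEquiv_of_end_eq_sub K hU hV hab' hb h' hD' hD).symm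
    · exact (boxMatrix_detEquiv_of_rows_eq K hU hV hab h' hD' hD).symm

theorem hgMatrix_detEquiv_of_isDirectionSet (hS : BoxConvex S)
    (hconn : IsEdgeConnected S) {P P' : OutsideDecomposition S} (hi : i ∈ diagonals S)
    (hP : IsDirectionSet P D) (hP' : IsDirectionSet P' (symmDiff D {i})) :
    DetEquiv (symmetricFunctions K) (hgMatrix K P) (hgMatrix K P') := by
  have hbox' := (hP'.hgMatrix_detEquiv K hS hconn).symm
  have hne : ∀ c, c ≠ i → (c ∈ D ↔ c ∈ symmDiff D {i}) := fun c hc => by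
    simp [Finset.mem_symmDiff, hc]
  have hmem : i ∈ symmDiff D {i} ↔ i ∉ D := by
    simp [Finset.mem_symmDiff]
  by_cases hi' : i + 1 ∈ diagonals S
  · refine ((hP.hgMatrix_detEquiv K hS hconn).trans ?_).trans hbox'
    by_cases hD : i ∈ D
    · exact boxMatrix_detEquiv K hS hconn hi hi' hne hD (by tauto)
    · exact (boxMatrix_detEquiv K hS hconn hi hi' (fun c hc => (hne c hc).symm) (by tauto) hD).symm
  -- Here `i` is the largest content, where directions are not compared, so the changed set is also
  -- a direction set of `P` and both matrices lead to the same box matrix.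
  · refine DetEquiv.trans (IsDirectionSet.hgMatrix_detEquiv K (fun b hb hb' => ?_) hS hconn) hbox'
    rw [← hne _ (by rintro rfl; exact hi' hb')]
    exact hP b hb hb'

end DiagonalShape

end

theorem theorem3p3 (K : Type*) [CommRing K] (lam mu : YoungDiagram) (hsub : mu ≤ lam)
    (hconn : IsEdgeConnected (skewDiagram lam mu))
    (P : OutsideDecomposition (skewDiagram lam mu))
    (i : ℤ) (hi : i ∈ diagonals (skewDiagram lam mu)) :
    ∃ P' : OutsideDecomposition (skewDiagram lam mu),
      (IsTwist i P P' ∧ ∀ Q : OutsideDecomposition (skewDiagram lam mu), IsTwist i P Q → Q = P') ∧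
      (∀ (m m' : ℕ) (e : Fin m ≃ {T // T ∈ P.parts}) (e' : Fin m' ≃ {T // T ∈ P'.parts}),
        ObtainableFrom (symmetricFunctions K) (hgExpr K P e) (hgExpr K P' e')) ∧
      hgDet K P' = hgDet K P := by
  have hS := skewDiagram_boxConvex lam mu hsub
  have hP := isDirectionSet_filter P hS
  have hP' := lineDecomposition_isDirectionSet _
    (symmDiff ((diagonals (skewDiagram lam mu)).filter fun c => DiagonalGoesUp P c) {i}) hS hconn
  have hdet := hgMatrix_detEquiv_of_isDirectionSet K hS hconn hi hP hP'
  refine ⟨_, ⟨hP.isTwist hP', fun Q hQ => (IsTwist.isDirectionSet hP hQ).unique hP'⟩,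
    fun m m' e e' => hdet 1 m m' e e', ?_⟩
  have hval := (hdet 1 _ _ (Fintype.equivFin _).symm (Fintype.equivFin _).symm).value_eq
  simpa [DetExpr.value, hgDet] using hval
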